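/- **Sums-over-paths.** For a finite set $V$ of variables, a *Boolean polynomial* is an element of $\mathbb F_2[V]/(v^2-v)_{v\in V}$. A *sum-over-paths* $t:n\to m$ is a term $t=s\sum_{\vec y\in\{0,1\}^V}e^{2i\pi P(\vec y)}|\vec O(\vec y)\rangle\langle\vec I(\vec y)|$ with $s\in\mathbb R$, $V$ a finite set of variables, $P\in\mathbb R[V]/(v^2-v)$, and $\vec O$ ($m$ entries), $\vec I$ ($n$ entries) tuples of Boolean polynomials. Terms are identified up to renaming of the variables, and the coefficients of $P$ are taken modulo $1$. Let $Q\mapsto\widehat Q$ be the map from Boolean polynomials to $\mathbb R[V]/(v^2-v)$ with $\widehat{v}=v$, $\widehat 0=0$, $\widehat 1=1$, $\widehat{QQ'}=\widehat Q\widehat{Q'}$, $\widehat{Q\oplus Q'}=\widehat Q+\widehat{Q'}-2\widehat Q\widehat{Q'}$. Put $f\circ g=\frac{s_fs_g}{2^m}\sum_{\vec y_f,\vec y_g,\vec y\in\{0,1\}^m}e^{2i\pi(P_g+P_f+\frac12(\widehat{\vec O_g}\cdot\vec y+\widehat{\vec I_f}\cdot\vec y))}|\vec O_f\rangle\langle\vec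 I_g|$ (with $m=|\vec I_f|=|\vec O_g|$) and $f\otimes g=s_fs_g\sum e^{2i\pi(P_g+P_f)}|\vec O_f\vec O_g\rangle\langle\vec I_f\vec I_g|$. The relation $\sim_{\mathrm{TH}}$ is the least equivalence relation on terms $n\to m$ containing the following rewrite steps. A substitution $t[y\leftarrow Q]$ replaces $y$ by $\widehat Q$ in $P$ and by $Q$ in $\vec O,\vec I$, and drops $y$ from the sum if it does not occur in $Q$. - (Elim) $s\sum_{V}e^{2i\pi P}|\vec O\rangle\langle\vec I|\to 2s\sum_{V\setminus\{y_0\}}e^{2i\pi P}|\vec O\rangle\langle\vec I|$ if $y_0\notin\mathrm{Var}(P,\vec O,\vec I)$; - (HHgen) $t=s\sum e^{2i\pi(\frac{y_0}2(y_i\widehat Q+\widehat{Q'}+1)+R)}|\vec O\rangle\langle\vec I|\to t[y_i\leftarrow1\oplus Q']$ if $y_0\ne y_i$, $y_0\notin\mathrm{Var}(Q,Q',R,\vec O,\vec I)$, $y_i\notin\mathrm{Var}(Q,Q')$ and $QQ'=Q'$; - (ket) $t\to t[y_0\leftarrow O_i]$ if $O_i=y_0\oplus O_i'$ with $O_i'\ne0$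 and $y_0\notin\mathrm{Var}(O_1,\dots,O_{i-1},O_i')$; - (bra) $t\to t[y_0\leftarrow I_i]$ if $I_i=y_0\oplus I_i'$ with $I_i'\neq0$ and $y_0\notin\mathrm{Var}(\vec O,I_1,\dots,I_{i-1},I_i')$; - (Z) $s\sum e^{2i\pi(\frac{y_0}2+R)}|\vec O\rangle\langle\vec I|\to\sum_{y_0}e^{2i\pi\frac{y_0}2}|\vec0\rangle\langle\vec0|$ if $y_0\notin\mathrm{Var}(R,\vec O,\vec I)$ and $R,\vec O,\vec I$ are not all zero. **Diagrams.** $\mathbf{ZH}_{\mathrm{TH}}$ consists of the diagrams built by sequential composition $\circ$ and parallel composition $\otimes$ from Z-spiders $Z^n_m:n\to m$, H-spiders $H^n_m:n\to m$ (with parameter $-1$), the scalar $\frac1{\sqrt2}:0\to0$, identities $id_n$, symmetries $\sigma_{n,m}$, cups $\eta_n:0\to 2n$ and caps $\epsilon_n:2n\to0$. Write $H=H^1_1$, $\frac12=\frac1{\sqrt2}\otimes\frac1{\sqrt2}$, $X^n_m=\frac12\otimes(H^{\otimes m}\circ Z^n_m\circ H^{\otimes n})$, and $|1\rangle=\frac12\otimes(H\circ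 Z^1_1\circ H^0_1)$ (the negated X-spider with one output). The relation $\mathrm{ZH}_{\mathrm{TH}}\vdash D_1=D_2$ is the least congruence for $\circ$, $\otimes$ and the dagger (which turns diagrams upside-down) that contains the axioms of a dagger-compact PROP, the invariance of both kinds of spiders under permuting and bending their legs, and the following rules, for all $n,m\ge 0$, where $\tau$ denotes the wiring that connects each of the $m$ (resp. $n$) upper spiders with each of the $n$ (resp. $m$) lower spiders by one wire: - (ZS1) $Z^1_m\circ Z^n_1=Z^n_m$; (ZS2) $Z^1_1=id_1$; - (HS1) $H^1_m\circ H\circ H^n_1=Z^0_0\otimes H^n_m$; (HS2) $H\circ H=Z^0_0\otimes id_1$; - (BA1) $(Z^m_1)^{\otimes n}\circ\tau\circ(X^1_n)^{\otimes m}=X^1_n\circ Z^m_1$; (BA2) $(Z^n_1)^{\otimes m}\circ\tau\circ(H^1_m)^{\otimes n}=H^1_m\circ X^n_1$; - (M) $Z^2_1\circ(H^0_1\otimes H^0_1)=Z^0_1$; (CPH) $H^1_2\circ H^0_1=Z^0_0\otimes|1\rangle\otimes|1\rangle$; (IP) $H^2_1\circ Z^1_2=H$; - (IV) $\frac12\otimes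 Z^0_0=id_0$; (Z) $\frac1{\sqrt2}\otimes(Z^1_0\circ H^0_1)=Z^1_0\circ H^0_1$. **Translation.** $[\cdot]^{\mathrm{sop}}$ sends $\circ$ and $\otimes$ to those of sums-over-paths and is given on generators by $[H^n_m]^{\mathrm{sop}}=\sum e^{2i\pi\frac12x_1\cdots x_ny_1\cdots y_m}|y_1,\dots,y_m\rangle\langle x_1,\dots,x_n|$, $[Z^n_m]^{\mathrm{sop}}=\sum_y|y,\dots,y\rangle\langle y,\dots,y|$, $[\frac1{\sqrt2}]^{\mathrm{sop}}=\frac1{\sqrt2}|\rangle\langle|$, $[id_n]^{\mathrm{sop}}=\sum|\vec y\rangle\langle\vec y|$, $[\sigma_{n,m}]^{\mathrm{sop}}=\sum|\vec y_2,\vec y_1\rangle\langle\vec y_1,\vec y_2|$, $[\eta_n]^{\mathrm{sop}}=\sum|\vec y,\vec y\rangle\langle|$, $[\epsilon_n]^{\mathrm{sop}}=\sum|\rangle\langle\vec y,\vec y|$. **Proposition.** For all diagrams $D_1,D_2:n\to m$ of $\mathbf{ZH}_{\mathrm{TH}}$, if $\mathrm{ZH}_{\mathrm{TH}}\vdash D_1=D_2$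 then $[D_1]^{\mathrm{sop}}\sim_{\mathrm{TH}}[D_2]^{\mathrm{sop}}$. -/

import Mathlib

/-! ### Polynomials with idempotent variables -/

/-- `BPoly R V` is the ring `R[X_v : v ∈ V] / (X_v ^ 2 - X_v)`. Boolean polynomials are the
elements of `BPoly (ZMod 2) V`; phase polynomials are elements of `BPoly ℝ V`. -/
abbrev BPoly (R : Type) [CommRing R] (V : Type) : Type :=
  MvPolynomial V R ⧸ Ideal.span
    (Set.range fun v : V => (MvPolynomial.X v ^ 2 - MvPolynomial.X v : MvPolynomial V R))

namespace BPoly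

/-- The variable `v`. -/
noncomputable def X (R : Type) [CommRing R] {V : Type} (v : V) : BPoly R V :=
  Ideal.Quotient.mk _ (MvPolynomial.X v)

/-- The constant `r`. -/
noncomputable def C {R : Type} [CommRing R] (V : Type) (r : R) : BPoly R V :=
  algebraMap R (BPoly R V) r

theorem X_mul_self (R : Type) [CommRing R] {V : Type} (v : V) : X R v * X R v = X R v := by
  have h : (Ideal.Quotient.mk (Ideal.span (Set.range fun v : V =>
      (MvPolynomial.X v ^ 2 - MvPolynomial.X v : MvPolynomial V R))))
      (MvPolynomial.X v ^ 2 - MvPolynomial.X v) = 0 :=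
    Ideal.Quotient.eq_zero_iff_mem.mpr (Ideal.subset_span ⟨v, rfl⟩)
  rw [map_sub, map_pow, sub_eq_zero, sq] at h
  exact h

/-- Evaluation of the variables at idempotents `a v` of an `R`-algebra. -/
noncomputable def lift {R : Type} [CommRing R] {V A : Type} [CommRing A] [Algebra R A]
    (a : V → A) (ha : ∀ v, a v * a v = a v) : BPoly R V →ₐ[R] A :=
  Ideal.Quotient.liftₐ _ (MvPolynomial.aeval a) (by
    intro p hp
    have hle : Ideal.span (Set.range fun v : V =>
        (MvPolynomial.X v ^ 2 - MvPolynomial.X v : MvPolynomial V R)) ≤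
        RingHom.ker (MvPolynomial.aeval a : MvPolynomial V R →ₐ[R] A) := by
      rw [Ideal.span_le]
      rintro _ ⟨v, rfl⟩
      simp [RingHom.mem_ker, sq, ha v]
    exact hle hp)

theorem lift_X {R : Type} [CommRing R] {V A : Type} [CommRing A] [Algebra R A]
    (a : V → A) (ha : ∀ v, a v * a v = a v) (v : V) :
    lift (R := R) a ha (X R v) = a v := by
  change (MvPolynomial.aeval a : MvPolynomial V R →ₐ[R] A) (MvPolynomial.X v) = a v
  simp

/-- Renaming of the variables along a map `f : V → W`. -/
noncomputable def rename {R : Type} [CommRing R] {V W : Type} (f : V → W) :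
    BPoly R V →ₐ[R] BPoly R W :=
  lift (fun v => X R (f v)) (fun v => X_mul_self R (f v))

/-- The set of variables of a polynomial: `v ∈ vars p` when `p` is not a polynomial expression
in the variables other than `v`. -/
def vars {R : Type} [CommRing R] {V : Type} (p : BPoly R V) : Set V :=
  {v | p ∉ Algebra.adjoin R (X R '' {w | w ≠ v})}

/-- The polynomials with integer coefficients. -/
def IsInteger {V : Type} (p : BPoly ℝ V) : Prop :=
  p ∈ Algebra.adjoin ℤ (Set.range (X ℝ : V → BPoly ℝ V))

theorem two_eq_zero (V : Type) : (2 : BPoly (ZMod 2) V) = 0 := by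
  have h := congrArg (algebraMap (ZMod 2) (BPoly (ZMod 2) V)) (show (2 : ZMod 2) = 0 by decide)
  rwa [map_ofNat, map_zero] at h

theorem bool_mul_self {V : Type} (p : BPoly (ZMod 2) V) : p * p = p := by
  obtain ⟨q, rfl⟩ := Ideal.Quotient.mk_surjective p
  induction q using MvPolynomial.induction_on with
  | C r =>
    rw [← map_mul, ← map_mul]
    congr 2
    revert r
    decide
  | add p q hp hq =>
    rw [map_add]
    linear_combination hp + hq +
      (Ideal.Quotient.mk _ p * Ideal.Quotient.mk _ q) * two_eq_zero V
  | mul_X p v hp =>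
    have hv := X_mul_self (ZMod 2) v
    unfold X at hv
    rw [map_mul]
    linear_combination (Ideal.Quotient.mk _ (MvPolynomial.X v) ^ 2) * hp +
      Ideal.Quotient.mk _ p * hv

/-- Substitution of Boolean polynomials for the variables of a Boolean polynomial. -/
noncomputable def subst {V W : Type} (σ : V → BPoly (ZMod 2) W) :
    BPoly (ZMod 2) V →ₐ[ZMod 2] BPoly (ZMod 2) W :=
  lift σ (fun v => bool_mul_self (σ v))

/-- The Boolean ring of the idempotents of `BPoly ℝ V`, with multiplication that of `BPoly ℝ V`
and addition `a + b - 2 * a * b` (see `Idem.coe_add`). -/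
abbrev Idem (V : Type) : Type := AsBoolRing {a : BPoly ℝ V // IsIdempotentElem a}

/-- The underlying polynomial of an idempotent. -/
noncomputable def Idem.coe {V : Type} (a : Idem V) : BPoly ℝ V := (ofBoolRing a).1

theorem Idem.coe_mul {V : Type} (a b : Idem V) : (a * b).coe = a.coe * b.coe := rfl

theorem Idem.coe_add {V : Type} (a b : Idem V) :
    (a + b).coe = a.coe + b.coe - 2 * a.coe * b.coe := by
  have ha : a.coe * a.coe = a.coe := (ofBoolRing a).2
  have hb : b.coe * b.coe = b.coe := (ofBoolRing b).2
  have h : (a + b).coe = a.coe * (1 - b.coe) + b.coe * (1 - a.coe)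
      - a.coe * (1 - b.coe) * (b.coe * (1 - a.coe)) := rfl
  rw [h]
  linear_combination (-b.coe ^ 2 + b.coe) * ha

noncomputable instance (V : Type) : Algebra (ZMod 2) (Idem V) :=
  haveI : CharP (Idem V) (ringChar (Idem V)) := ringChar.charP _
  (ZMod.castHom (n := 2) (m := ringChar (Idem V))
    (ringChar.dvd (by
      have h := BooleanRing.add_self (1 : Idem V)
      rw [one_add_one_eq_two] at h
      exact_mod_cast h)) (Idem V)).toAlgebra

/-- The translation of Boolean polynomials to phase polynomials, as a ring homomorphism to the
Boolean ring of idempotents; it is determined by `hat_X`, `hat_add`, `hat_mul`, `hat_zero` and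
`hat_one` below. -/
noncomputable def hatHom (V : Type) : BPoly (ZMod 2) V →ₐ[ZMod 2] Idem V :=
  lift (fun v => toBoolRing ⟨X ℝ v, X_mul_self ℝ v⟩) (fun _ => BooleanRing.mul_self _)

/-- The phase polynomial with values in `{0,1}` that a Boolean polynomial denotes. -/
noncomputable def hat {V : Type} (Q : BPoly (ZMod 2) V) : BPoly ℝ V := (hatHom V Q).coe

theorem hat_X {V : Type} (v : V) : hat (X (ZMod 2) v) = X ℝ v := by
  unfold hat hatHom
  rw [lift_X]
  rfl

theorem hat_add {V : Type} (Q Q' : BPoly (ZMod 2) V) :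
    hat (Q + Q') = hat Q + hat Q' - 2 * hat Q * hat Q' := by
  unfold hat
  rw [map_add, Idem.coe_add]

theorem hat_mul {V : Type} (Q Q' : BPoly (ZMod 2) V) : hat (Q * Q') = hat Q * hat Q' := by
  unfold hat
  rw [map_mul, Idem.coe_mul]

theorem hat_zero {V : Type} : hat (0 : BPoly (ZMod 2) V) = 0 := by
  unfold hat
  rw [map_zero]
  rfl

theorem hat_one {V : Type} : hat (1 : BPoly (ZMod 2) V) = 1 := by
  unfold hat
  rw [map_one]
  rfl

theorem hat_mul_self {V : Type} (Q : BPoly (ZMod 2) V) : hat Q * hat Q = hat Q := by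
  rw [← hat_mul, bool_mul_self]

/-- Substitution of Boolean polynomials for the variables of a phase polynomial. -/
noncomputable def substPhase {V W : Type} (σ : V → BPoly (ZMod 2) W) :
    BPoly ℝ V →ₐ[ℝ] BPoly ℝ W :=
  lift (fun v => hat (σ v)) (fun v => hat_mul_self (σ v))

end BPoly

/-! ### Sums-over-paths -/

/-- The morphism `s ∑_{y ∈ {0,1}^V} e^{2iπ P(y)} |O(y)⟩⟨I(y)|` with `n` inputs and `m` outputs;
`V` is its finite set of variables. -/
structure SOP (n m : ℕ) : Type 1 where
  V : Type
  [fin : Finite V]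
  s : ℝ
  P : BPoly ℝ V
  O : Fin m → BPoly (ZMod 2) V
  I : Fin n → BPoly (ZMod 2) V

attribute [instance] SOP.fin

namespace SOP

open BPoly

/-- Sequential composition, `f` after `g`. -/
noncomputable def comp {n m k : ℕ} (f : SOP m k) (g : SOP n m) : SOP n k where
  V := f.V ⊕ g.V ⊕ Fin m
  s := f.s * g.s / 2 ^ m
  P := rename (fun v => Sum.inr (Sum.inl v)) g.P + rename Sum.inl f.P +
    C _ (1 / 2) * ∑ i : Fin m,
      (hat (rename (fun v => Sum.inr (Sum.inl v)) (g.O i)) + hat (rename Sum.inl (f.I i))) *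
        X ℝ (Sum.inr (Sum.inr i))
  O := fun i => rename Sum.inl (f.O i)
  I := fun i => rename (fun v => Sum.inr (Sum.inl v)) (g.I i)

/-- Parallel composition. -/
noncomputable def tensor {n m n' m' : ℕ} (f : SOP n m) (g : SOP n' m') :
    SOP (n + n') (m + m') where
  V := f.V ⊕ g.V
  s := f.s * g.s
  P := rename Sum.inr g.P + rename Sum.inl f.P
  O := Fin.append (fun i => rename Sum.inl (f.O i)) (fun i => rename Sum.inr (g.O i))
  I := Fin.append (fun i => rename Sum.inl (f.I i)) (fun i => rename Sum.inr (g.I i))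

/-- The identity. -/
noncomputable def id (n : ℕ) : SOP n n where
  V := Fin n
  s := 1
  P := 0
  O := fun i => X _ i
  I := fun i => X _ i

/-- The symmetric braiding. -/
noncomputable def swap (n m : ℕ) : SOP (n + m) (m + n) where
  V := Fin n ⊕ Fin m
  s := 1
  P := 0
  O := Fin.append (fun j => X _ (Sum.inr j)) (fun i => X _ (Sum.inl i))
  I := Fin.append (fun i => X _ (Sum.inl i)) (fun j => X _ (Sum.inr j))

/-- The unit `η_n` of the compact structure. -/
noncomputable def cup (n : ℕ) : SOP 0 (n + n) where
  V := Fin n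
  s := 1
  P := 0
  O := Fin.append (fun i => X _ i) (fun i => X _ i)
  I := Fin.elim0

/-- The counit `ε_n` of the compact structure. -/
noncomputable def cap (n : ℕ) : SOP (n + n) 0 where
  V := Fin n
  s := 1
  P := 0
  O := Fin.elim0
  I := Fin.append (fun i => X _ i) (fun i => X _ i)

/-- The substitution `t[y ← σ]`; the sum of the result ranges over the variables `W` of the
substituted polynomials. -/
noncomputable def subst {n m : ℕ} (t : SOP n m) {W : Type} [Finite W]
    (σ : t.V → BPoly (ZMod 2) W) : SOP n m where
  V := W
  s := t.s
  P := substPhase σ t.P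
  O := fun i => BPoly.subst σ (t.O i)
  I := fun i => BPoly.subst σ (t.I i)

/-- Equality of morphisms: renaming of the bound variables, and equality modulo `1` of the
coefficients of the phase polynomial. -/
inductive Same {n m : ℕ} : SOP n m → SOP n m → Prop
  | alpha (t : SOP n m) {W : Type} [Finite W] (e : t.V ≃ W) :
      Same t ⟨W, t.s, rename e t.P, fun i => rename e (t.O i), fun i => rename e (t.I i)⟩
  | modOne {V : Type} [Finite V] (s : ℝ) (P P' : BPoly ℝ V) (O : Fin m → BPoly (ZMod 2) V)
      (I : Fin n → BPoly (ZMod 2) V) (h : IsInteger (P - P')) :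
      Same ⟨V, s, P, O, I⟩ ⟨V, s, P', O, I⟩

open Classical in
/-- One rewrite step. In a term over `Option W`, the variable `none` is the one that the rule
removes from the sum (for `z`, the only one that it keeps); a polynomial over `Option W` obtained
by renaming along `some` is one in which `none` does not occur. -/
inductive Step {n m : ℕ} : SOP n m → SOP n m → Prop
  /-- `∑ e^{2iπP}|O⟩⟨I| ⟶ 2 ∑_{y ∖ y₀} e^{2iπP}|O⟩⟨I|` when `y₀ = none` does not occur. -/
  | elim {W : Type} [Finite W] (s : ℝ) (P : BPoly ℝ W) (O : Fin m → BPoly (ZMod 2) W)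
      (I : Fin n → BPoly (ZMod 2) W) :
      Step
        ⟨Option W, s, rename some P, fun i => rename some (O i), fun i => rename some (I i)⟩
        ⟨W, 2 * s, P, O, I⟩
  /-- `t = ∑ e^{2iπ(y₀/2 (yᵢ Q + Q' + 1) + R)}|O⟩⟨I| ⟶ t[yᵢ ← 1 ⊕ Q']` when `Q Q' = Q'`, `y₀` does
  not occur in `Q, Q', R, O, I` and `yᵢ = none` does not occur in `Q, Q'`. -/
  | hhgen {W : Type} [Finite W] (s : ℝ) (y₀ : W) (Q Q' : BPoly (ZMod 2) W)
      (R : BPoly ℝ (Option W)) (O : Fin m → BPoly (ZMod 2) (Option W))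
      (I : Fin n → BPoly (ZMod 2) (Option W))
      (hQ : y₀ ∉ vars Q) (hQ' : y₀ ∉ vars Q') (hR : some y₀ ∉ vars R)
      (hO : ∀ i, some y₀ ∉ vars (O i)) (hI : ∀ i, some y₀ ∉ vars (I i)) (hQQ' : Q * Q' = Q') :
      Step
        ⟨Option W, s, C _ (1 / 2) * X ℝ (some y₀) *
          (X ℝ none * rename some (hat Q) + rename some (hat Q') + 1) + R, O, I⟩
        (subst
          ⟨Option W, s, C _ (1 / 2) * X ℝ (some y₀) *
            (X ℝ none * rename some (hat Q) + rename some (hat Q') + 1) + R, O, I⟩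
          (fun v : Option W => v.elim (1 + Q') (fun w => X (ZMod 2) w)))
  /-- `t[y₀ ← Oᵢ]` when `Oᵢ = y₀ ⊕ O'`, `O' ≠ 0` and `y₀` does not occur in `O₁, …, Oᵢ₋₁, O'`. -/
  | ket (t : SOP n m) (i : Fin m) (y₀ : t.V) (O' : BPoly (ZMod 2) t.V)
      (hi : t.O i = X _ y₀ + O') (h0 : O' ≠ 0) (hO' : y₀ ∉ vars O')
      (hO : ∀ j < i, y₀ ∉ vars (t.O j)) :
      Step t (t.subst (Function.update (fun v => X (ZMod 2) v) y₀ (t.O i)))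
  /-- `t[y₀ ← Iᵢ]` when `Iᵢ = y₀ ⊕ I'`, `I' ≠ 0` and `y₀` does not occur in
  `O, I₁, …, Iᵢ₋₁, I'`. -/
  | bra (t : SOP n m) (i : Fin n) (y₀ : t.V) (I' : BPoly (ZMod 2) t.V)
      (hi : t.I i = X _ y₀ + I') (h0 : I' ≠ 0) (hI' : y₀ ∉ vars I')
      (hO : ∀ j, y₀ ∉ vars (t.O j)) (hI : ∀ j < i, y₀ ∉ vars (t.I j)) :
      Step t (t.subst (Function.update (fun v => X (ZMod 2) v) y₀ (t.I i)))
  /-- `s ∑ e^{2iπ(y₀/2 + R)}|O⟩⟨I| ⟶ ∑_{y₀} e^{2iπ y₀/2}|0⟩⟨0|` when `R`, `O`, `I` are not all zero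
  and `y₀ = none` does not occur in them. -/
  | z {W : Type} [Finite W] (s : ℝ) (R : BPoly ℝ W) (O : Fin m → BPoly (ZMod 2) W)
      (I : Fin n → BPoly (ZMod 2) W) (h : R ≠ 0 ∨ O ≠ 0 ∨ I ≠ 0) :
      Step
        ⟨Option W, s, C _ (1 / 2) * X ℝ none + rename some R,
          fun i => rename some (O i), fun i => rename some (I i)⟩
        ⟨Unit, 1, C _ (1 / 2) * X ℝ (), fun _ => 0, fun _ => 0⟩

/-- The equational theory induced by the rewrite system: the least equivalence relation that
contains equality of morphisms and the rewrite steps. -/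
def THEquiv {n m : ℕ} (t₁ t₂ : SOP n m) : Prop :=
  Relation.EqvGen (fun t t' => Same t t' ∨ Step t t') t₁ t₂

end SOP

/-! ### Toffoli-Hadamard ZH-diagrams -/

/-- Diagrams with `n` inputs and `m` outputs of the Toffoli-Hadamard fragment of ZH, as formal
compositions of the Z-spiders, the H-spiders with parameter `-1`, the scalar `1/√2`, and the
structural morphisms of a compact PROP. -/
inductive ZHTH : ℕ → ℕ → Type
  | Z (n m : ℕ) : ZHTH n m
  | H (n m : ℕ) : ZHTH n m
  | sqrtHalf : ZHTH 0 0
  | id (n : ℕ) : ZHTH n n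
  | swap (n m : ℕ) : ZHTH (n + m) (m + n)
  | cup (n : ℕ) : ZHTH 0 (n + n)
  | cap (n : ℕ) : ZHTH (n + n) 0
  | comp {n m k : ℕ} (f : ZHTH m k) (g : ZHTH n m) : ZHTH n k
  | tensor {n m n' m' : ℕ} (f : ZHTH n m) (g : ZHTH n' m') : ZHTH (n + n') (m + m')

infixr:70 " ∘z " => ZHTH.comp
infixr:75 " ⊗z " => ZHTH.tensor

namespace ZHTH

/-- Transport along equalities of the numbers of inputs and outputs. -/
def cast {n n' m m' : ℕ} (hn : n = n') (hm : m = m') (D : ZHTH n m) : ZHTH n' m' :=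
  hn ▸ hm ▸ D

/-- The dagger: the diagram upside-down (the parameters `-1` and `1/√2` are real). -/
def dagger : {n m : ℕ} → ZHTH n m → ZHTH m n
  | _, _, Z n m => Z m n
  | _, _, H n m => H m n
  | _, _, sqrtHalf => sqrtHalf
  | _, _, id n => id n
  | _, _, swap n m => swap m n
  | _, _, cup n => cap n
  | _, _, cap n => cup n
  | _, _, comp f g => g.dagger ∘z f.dagger
  | _, _, tensor f g => f.dagger ⊗z g.dagger

/-- The translation of diagrams to sums-over-paths. -/
noncomputable def toSOP : {n m : ℕ} → ZHTH n m → SOP n m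
  | _, _, Z _ _ => ⟨Unit, 1, 0, fun _ => BPoly.X _ (), fun _ => BPoly.X _ ()⟩
  | _, _, H n m => ⟨Fin n ⊕ Fin m, 1,
      BPoly.C _ (1 / 2) * ((∏ i, BPoly.X ℝ (Sum.inl i)) * ∏ j, BPoly.X ℝ (Sum.inr j)),
      fun j => BPoly.X _ (Sum.inr j), fun i => BPoly.X _ (Sum.inl i)⟩
  | _, _, sqrtHalf => ⟨Empty, 1 / Real.sqrt 2, 0, Fin.elim0, Fin.elim0⟩
  | _, _, id n => SOP.id n
  | _, _, swap n m => SOP.swap n m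
  | _, _, cup n => SOP.cup n
  | _, _, cap n => SOP.cap n
  | _, _, comp f g => f.toSOP.comp g.toSOP
  | _, _, tensor f g => f.toSOP.tensor g.toSOP

/-- The scalar `1/2`. -/
def half : ZHTH 0 0 := sqrtHalf ⊗z sqrtHalf

/-- `n` parallel Hadamard boxes, that is H-spiders with one input and one output. -/
def hadamards : (n : ℕ) → ZHTH n n
  | 0 => id 0
  | n + 1 => hadamards n ⊗z H 1 1

/-- The X-spider: a Z-spider with Hadamard boxes on all legs, times `1/2`. -/
def X (n m : ℕ) : ZHTH n m := (hadamards m ∘z Z n m ∘z hadamards n) ⊗z half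

/-- The negated X-spider: the X-spider with the phase `-1` on its Z-spider. -/
def Xneg (n m : ℕ) : ZHTH n m :=
  (hadamards m ∘z Z (n + 1) m ∘z (hadamards n ⊗z H 0 1)) ⊗z half

/-- `k` parallel copies of a diagram with one input. -/
def rowIn {b : ℕ} (D : ZHTH 1 b) : (k : ℕ) → ZHTH k (b * k)
  | 0 => id 0
  | k + 1 => rowIn D k ⊗z D

/-- `k` parallel copies of a diagram with one output. -/
def rowOut {a : ℕ} (D : ZHTH a 1) : (k : ℕ) → ZHTH (a * k) k
  | 0 => id 0
  | k + 1 => rowOut D k ⊗z D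

/-- The wires are `n` groups of `m`, followed by `n` single wires; the `j`-th single wire is
moved to the end of the `j`-th group. -/
def interleave (m : ℕ) : (n : ℕ) → ZHTH (m * n + n) ((m + 1) * n)
  | 0 => id 0
  | n + 1 =>
    (interleave m n ⊗z id (m + 1)) ∘z
      cast (by ring) (by ring) (id (m * n) ⊗z swap m n ⊗z id 1)

/-- The permutation of wires that turns `m` groups of `n` wires into `n` groups of `m`: the `j`-th
wire of the `i`-th group becomes the `i`-th wire of the `j`-th group. -/
def shuffle (n : ℕ) : (m : ℕ) → ZHTH (n * m) (m * n)
  | 0 => cast rfl (Nat.zero_mul n).symm (id 0)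
  | m + 1 => interleave m n ∘z (shuffle n m ⊗z id n)

/-- `Derivable D₁ D₂`: the equation `D₁ = D₂` is derivable in the axiomatisation `ZH_TH`. -/
inductive Derivable : {n m : ℕ} → ZHTH n m → ZHTH n m → Prop
  -- Equational reasoning in context.
  | refl {n m : ℕ} (D : ZHTH n m) : Derivable D D
  | symm {n m : ℕ} {D D' : ZHTH n m} : Derivable D D' → Derivable D' D
  | trans {n m : ℕ} {D D' D'' : ZHTH n m} : Derivable D D' → Derivable D' D'' → Derivable D D''
  | comp {n m k : ℕ} {f f' : ZHTH m k} {g g' : ZHTH n m} :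
      Derivable f f' → Derivable g g' → Derivable (f ∘z g) (f' ∘z g')
  | tensor {n m n' m' : ℕ} {f f' : ZHTH n m} {g g' : ZHTH n' m'} :
      Derivable f f' → Derivable g g' → Derivable (f ⊗z g) (f' ⊗z g')
  | dagger {n m : ℕ} {D D' : ZHTH n m} : Derivable D D' → Derivable D.dagger D'.dagger
  -- Axioms of a strict symmetric monoidal category.
  | id_comp {n m : ℕ} (D : ZHTH n m) : Derivable (id m ∘z D) D
  | comp_id {n m : ℕ} (D : ZHTH n m) : Derivable (D ∘z id n) D
  | comp_assoc {n m k l : ℕ} (f : ZHTH k l) (g : ZHTH m k) (h : ZHTH n m) :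
      Derivable ((f ∘z g) ∘z h) (f ∘z g ∘z h)
  | tensor_id (n m : ℕ) : Derivable (id n ⊗z id m) (id (n + m))
  | interchange {n m k n' m' k' : ℕ} (f : ZHTH m k) (g : ZHTH n m) (f' : ZHTH m' k')
      (g' : ZHTH n' m') :
      Derivable ((f ⊗z f') ∘z (g ⊗z g')) ((f ∘z g) ⊗z (f' ∘z g'))
  | tensor_assoc {n m n' m' n'' m'' : ℕ} (f : ZHTH n m) (g : ZHTH n' m') (h : ZHTH n'' m'') :
      Derivable ((f ⊗z g) ⊗z h)
        (cast (Nat.add_assoc n n' n'').symm (Nat.add_assoc m m' m'').symm (f ⊗z g ⊗z h))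
  | unit_tensor {n m : ℕ} (D : ZHTH n m) :
      Derivable (cast (Nat.zero_add n) (Nat.zero_add m) (id 0 ⊗z D)) D
  | tensor_unit {n m : ℕ} (D : ZHTH n m) : Derivable (D ⊗z id 0) D
  | swap_natural {n m n' m' : ℕ} (f : ZHTH n m) (g : ZHTH n' m') :
      Derivable (swap m m' ∘z (f ⊗z g)) ((g ⊗z f) ∘z swap n n')
  | swap_swap (n m : ℕ) : Derivable (swap m n ∘z swap n m) (id (n + m))
  | hexagon (n m k : ℕ) :
      Derivable (swap n (m + k))
        (cast (Nat.add_assoc n m k) (Nat.add_assoc m k n).symm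
          ((id m ⊗z swap n k) ∘z cast rfl (Nat.add_assoc m n k) (swap n m ⊗z id k)))
  -- Axioms of the compact structure.
  | snake (n : ℕ) :
      Derivable
        (cast (Nat.add_zero n) (Nat.zero_add n)
          ((cap n ⊗z id n) ∘z cast rfl (Nat.add_assoc n n n).symm (id n ⊗z cup n)))
        (id n)
  | swap_cup (n : ℕ) : Derivable (swap n n ∘z cup n) (cup n)
  | cup_zero : Derivable (cup 0) (id 0)
  | cup_add (n m : ℕ) :
      Derivable (cup (n + m))
        (cast rfl (by ring)
          ((id n ⊗z swap n m ⊗z id m) ∘z cast rfl (by ring) (cup n ⊗z cup m)))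
  -- Spiders are invariant under permuting and bending their legs.
  | Z_perm (a b m : ℕ) :
      Derivable (Z (a + ((1 + 1) + b)) m ∘z (id a ⊗z swap 1 1 ⊗z id b)) (Z (a + ((1 + 1) + b)) m)
  | H_perm (a b m : ℕ) :
      Derivable (H (a + ((1 + 1) + b)) m ∘z (id a ⊗z swap 1 1 ⊗z id b)) (H (a + ((1 + 1) + b)) m)
  | Z_bend (n m : ℕ) :
      Derivable (Z n (m + 1))
        ((Z (n + 1) m ⊗z id 1) ∘z cast (Nat.add_zero n) (Nat.add_assoc n 1 1).symm (id n ⊗z cup 1))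
  | H_bend (n m : ℕ) :
      Derivable (H n (m + 1))
        ((H (n + 1) m ⊗z id 1) ∘z cast (Nat.add_zero n) (Nat.add_assoc n 1 1).symm (id n ⊗z cup 1))
  -- The rules of the axiomatisation `ZH_TH`; `Z 0 0` is the scalar `2`.
  | ZS1 (n m : ℕ) : Derivable (Z 1 m ∘z Z n 1) (Z n m)
  | ZS2 : Derivable (Z 1 1) (id 1)
  | HS1 (n m : ℕ) : Derivable (H 1 m ∘z H 1 1 ∘z H n 1) (H n m ⊗z Z 0 0)
  | HS2 : Derivable (H 1 1 ∘z H 1 1) (id 1 ⊗z Z 0 0)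
  | BA1 (n m : ℕ) :
      Derivable (rowOut (Z m 1) n ∘z shuffle n m ∘z rowIn (X 1 n) m) (X 1 n ∘z Z m 1)
  | BA2 (n m : ℕ) :
      Derivable (rowOut (Z n 1) m ∘z shuffle m n ∘z rowIn (H 1 m) n) (H 1 m ∘z X n 1)
  | M : Derivable (Z 2 1 ∘z (H 0 1 ⊗z H 0 1)) (Z 0 1)
  | CPH : Derivable (H 1 2 ∘z H 0 1) ((Xneg 0 1 ⊗z Xneg 0 1) ⊗z Z 0 0)
  | IP : Derivable (H 2 1 ∘z Z 1 2) (H 1 1)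
  | IV : Derivable (half ⊗z Z 0 0) (id 0)
  | Z0 : Derivable (sqrtHalf ⊗z (Z 1 0 ∘z H 0 1)) (Z 1 0 ∘z H 0 1)

end ZHTH

/-! Provable equality is compared with `∼_TH` through matrices; no congruence property of the
rewriting is needed. A diagram denotes a real matrix `sem`. Two facts suffice: every rule of the
calculus preserves this matrix (`ZHTH.Derivable.sem_eq`), and two translated diagrams with the same
matrix are related by rewriting (`SOP.Denotes.equiv`, applicable by `denotes_sem`).

The second fact is a completeness statement. Modulo one, the phase of a translated diagram is half a
Boolean polynomial, and its scalar is a power of `√2`. Boolean polynomials are Boolean functions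
(`ev_bijective`), so such a term is a scalar `s` with a function from assignments to labels (sign,
output, input), written `ofFun`. Its matrix entry is `s` times the net number of assignments,
counted with sign, for that output and input.

Completeness then becomes counting. Rule `hhgen` with `Q = 1`, followed by `elim`, introduces or
removes a variable forced to a given Boolean value (`ofFun_hh`). Introducing a variable and removing
another gives controlled flips of one bit (`ofFun_shear`). These generate all permutations of the
assignments (`ofFun_perm`), so only the number of assignments of each label matters
(`ofFun_of_card`). Adding pairs of opposite sign reduces this to the net numbers (`ofFun_of_net`).
For nonzero matrices, irrationality of `√2` makes the two scalars differ by a power of `2`, and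
padding equalises scalars and numbers of variables (`ofFun_pad`). For the zero matrix, rule `z`
discards the scalar (`ofFun_zero`). Together these give `ofFun_complete`. -/

namespace BPoly

/-! ### Extensionality and induction for polynomials in idempotent variables. -/

theorem algHom_ext {R : Type} [CommRing R] {V A : Type} [CommRing A] [Algebra R A]
    {f g : BPoly R V →ₐ[R] A} (h : ∀ v, f (X R v) = g (X R v)) : f = g := by
  apply Ideal.Quotient.algHom_ext
  apply MvPolynomial.algHom_ext
  exact h

theorem rename_X {R : Type} [CommRing R] {V W : Type} (f : V → W) (v : V) :
    rename f (X R v) = X R (f v) :=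
  lift_X _ _ _

theorem induction {V : Type} {p : BPoly (ZMod 2) V → Prop} (zero : p 0) (one : p 1)
    (var : ∀ v, p (X _ v)) (add : ∀ a b, p a → p b → p (a + b))
    (mul : ∀ a b, p a → p b → p (a * b)) (q : BPoly (ZMod 2) V) : p q := by
  obtain ⟨q, rfl⟩ := Ideal.Quotient.mk_surjective q
  induction q using MvPolynomial.induction_on with
  | C r =>
    have hr : r = 0 ∨ r = 1 := by revert r; decide
    rcases hr with rfl | rfl
    · simpa using zero
    · simpa using one
  | add a b ha hb => simpa using add _ _ ha hb
  | mul_X a v ha => rw [map_mul]; exact mul _ _ ha (var v)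

/-! ### Boolean polynomials as Boolean functions -/

/-- Evaluation of a Boolean polynomial at a Boolean assignment. -/
noncomputable def ev {V : Type} (a : V → ZMod 2) : BPoly (ZMod 2) V →ₐ[ZMod 2] ZMod 2 :=
  lift a (fun v => by generalize a v = x; revert x; decide)

@[simp]
theorem ev_X {V : Type} (a : V → ZMod 2) (v : V) : ev a (X _ v) = a v :=
  lift_X _ _ _

@[simp]
theorem ev_rename {V W : Type} (f : V → W) (a : W → ZMod 2) (p : BPoly (ZMod 2) V) :
    ev a (rename f p) = ev (fun v => a (f v)) p := by
  have h : (ev a).comp (rename f) = ev (fun v => a (f v)) :=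
    algHom_ext fun v => by simp [rename_X]
  exact DFunLike.congr_fun h p

@[simp]
theorem ev_subst {V W : Type} (σ : V → BPoly (ZMod 2) W) (a : W → ZMod 2)
    (p : BPoly (ZMod 2) V) : ev a (subst σ p) = ev (fun v => ev a (σ v)) p := by
  have h : (ev a).comp (subst σ) = ev (fun v => ev a (σ v)) :=
    algHom_ext fun v => by simp [subst, lift_X]
  exact DFunLike.congr_fun h p

/-- The polynomial that is `1` exactly at `a`. -/
noncomputable def delta {V : Type} [Fintype V] (a : V → ZMod 2) : BPoly (ZMod 2) V :=
  ∏ v, (X _ v + algebraMap (ZMod 2) _ (a v) + 1)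

theorem ev_delta {V : Type} [Fintype V] (a b : V → ZMod 2) [Decidable (b = a)] :
    ev b (delta a) = if b = a then 1 else 0 := by
  have key : ∀ x y : ZMod 2, x + y + 1 = 0 ↔ x ≠ y := by decide
  have key' : ∀ x : ZMod 2, x + x + 1 = 1 := by decide
  simp only [delta, map_prod, map_add, ev_X, map_one, AlgHom.commutes]
  simp only [Algebra.algebraMap_self, RingHom.id_apply]
  split_ifs with h
  · subst h
    exact Finset.prod_eq_one fun v _ => key' _
  · obtain ⟨v, hv⟩ := Function.ne_iff.mp h
    exact Finset.prod_eq_zero (Finset.mem_univ v) ((key _ _).mpr hv)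

/-- For a variable, idempotence and characteristic two give `v (v + a v + 1) = a v (v + a v + 1)`.
Sums and products inherit the property. -/
theorem mul_delta {V : Type} [Fintype V] (a : V → ZMod 2) (p : BPoly (ZMod 2) V) :
    p * delta a = algebraMap (ZMod 2) _ (ev a p) * delta a := by
  induction p using induction with
  | zero => simp
  | one => simp
  | var v =>
    classical
    have hX := X_mul_self (ZMod 2) v
    have h2 := two_eq_zero V
    have hv : (X _ v : BPoly (ZMod 2) V) * (X _ v + algebraMap (ZMod 2) _ (a v) + 1) =
        algebraMap (ZMod 2) _ (a v) * (X _ v + algebraMap (ZMod 2) _ (a v) + 1) := by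
      have hr : a v = 0 ∨ a v = 1 := by generalize a v = x; revert x; decide
      rcases hr with hr | hr
      · rw [hr, map_zero]; linear_combination hX + X _ v * h2
      · rw [hr, map_one]; linear_combination hX + (-1 + X _ v) * h2
    rw [delta, ev_X, ← Finset.mul_prod_erase _ _ (Finset.mem_univ v), ← mul_assoc, hv, mul_assoc]
  | add p q hp hq => rw [add_mul, hp, hq, map_add, map_add, add_mul]
  | mul p q hp hq =>
    rw [mul_assoc, hq, mul_left_comm, hp, map_mul, map_mul]
    ring

/-- Expand the product over `v` of `(v + 0 + 1) + (v + 1 + 1)`, each factor of which is `1`. -/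
theorem sum_delta (V : Type) [Fintype V] [DecidableEq V] :
    ∑ a : V → ZMod 2, delta a = (1 : BPoly (ZMod 2) V) := by
  have h : ∀ v : V, ∑ x : ZMod 2, (X _ v + algebraMap (ZMod 2) (BPoly (ZMod 2) V) x + 1) = 1 := by
    intro v
    have h2 := two_eq_zero V
    have : ∑ x : ZMod 2, (X _ v + algebraMap (ZMod 2) (BPoly (ZMod 2) V) x + 1) =
      (X _ v + algebraMap (ZMod 2) (BPoly (ZMod 2) V) 0 + 1) +
      (X _ v + algebraMap (ZMod 2) (BPoly (ZMod 2) V) 1 + 1) := Fin.sum_univ_two _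
    rw [this, map_zero, map_one]
    linear_combination (X _ v + 1) * h2
  have := Finset.prod_univ_sum (fun _ : V => (Finset.univ : Finset (ZMod 2)))
    (fun v x => X _ v + algebraMap (ZMod 2) (BPoly (ZMod 2) V) x + 1)
  simp only [h, Finset.prod_const_one, Fintype.piFinset_univ] at this
  exact this.symm

/-- The `delta a` form a partition of unity, so `p` is the sum of the `ev a p * delta a`: it is
determined by its values, and these can be prescribed. -/
theorem ev_bijective (V : Type) [Finite V] :
    Function.Bijective fun (p : BPoly (ZMod 2) V) (a : V → ZMod 2) => ev a p := by
  classical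
  have := Fintype.ofFinite V
  constructor
  · intro p q h
    have hpq : ∀ a : V → ZMod 2, ev a p = ev a q := congrFun h
    rw [← mul_one p, ← mul_one q, ← sum_delta V, Finset.mul_sum, Finset.mul_sum]
    exact Finset.sum_congr rfl fun a _ => by rw [mul_delta a p, mul_delta a q, hpq]
  · intro f
    refine ⟨∑ a, algebraMap (ZMod 2) _ (f a) * delta a, ?_⟩
    funext b
    simp [ev_delta]

theorem ev_ext {V : Type} [Finite V] {p q : BPoly (ZMod 2) V} (h : ∀ a, ev a p = ev a q) :
    p = q :=
  (ev_bijective V).1 (funext h)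

/-- The Boolean polynomial with given values. -/
noncomputable def poly {V : Type} [Finite V] (f : (V → ZMod 2) → ZMod 2) : BPoly (ZMod 2) V :=
  Function.surjInv (ev_bijective V).2 f

@[simp]
theorem ev_poly {V : Type} [Finite V] (f : (V → ZMod 2) → ZMod 2) (a : V → ZMod 2) :
    ev a (poly f) = f a :=
  congrFun (Function.surjInv_eq (ev_bijective V).2 f) a

/-! ### Phases modulo one -/

theorem rename_hat {V W : Type} (f : V → W) (p : BPoly (ZMod 2) V) :
    rename f (hat p) = hat (rename f p) := by
  induction p using induction with
  | zero => simp [hat_zero]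
  | one => simp [hat_one]
  | var v => simp [hat_X, rename_X]
  | add p q hp hq => rw [hat_add, map_sub, map_add, map_mul, map_mul, map_ofNat, hp, hq, map_add, hat_add]
  | mul p q hp hq => simp [hat_mul, hp, hq]

theorem substPhase_hat {V W : Type} (σ : V → BPoly (ZMod 2) W) (p : BPoly (ZMod 2) V) :
    substPhase σ (hat p) = hat (subst σ p) := by
  induction p using induction with
  | zero => simp [hat_zero]
  | one => simp [hat_one]
  | var v => simp [hat_X, substPhase, subst, lift_X]
  | add p q hp hq => rw [hat_add, map_sub, map_add, map_mul, map_mul, map_ofNat, hp, hq, map_add, hat_add]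
  | mul p q hp hq => simp [hat_mul, hp, hq]

theorem isInteger_hat {V : Type} (p : BPoly (ZMod 2) V) : IsInteger (hat p) := by
  unfold IsInteger
  induction p using induction with
  | zero => rw [hat_zero]; exact zero_mem _
  | one => rw [hat_one]; exact one_mem _
  | var v => rw [hat_X]; exact Algebra.subset_adjoin ⟨v, rfl⟩
  | add p q hp hq =>
    rw [hat_add]
    exact sub_mem (add_mem hp hq) (mul_mem (mul_mem (ofNat_mem _ 2) hp) hq)
  | mul p q hp hq => rw [hat_mul]; exact mul_mem hp hq

/-- The phase polynomials with integer coefficients. -/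
noncomputable def integers (V : Type) : AddSubgroup (BPoly ℝ V) :=
  (Algebra.adjoin ℤ (Set.range (X ℝ : V → BPoly ℝ V))).toSubring.toAddSubgroup

/-- The class of a phase polynomial modulo one. -/
noncomputable def modOne {V : Type} : BPoly ℝ V →+ BPoly ℝ V ⧸ integers V :=
  QuotientAddGroup.mk' _

theorem modOne_eq_iff {V : Type} {p q : BPoly ℝ V} :
    modOne p = modOne q ↔ IsInteger (p - q) := by
  rw [eq_comm]
  refine QuotientAddGroup.eq.trans ?_
  rw [neg_add_eq_sub]
  rfl

theorem C_half_add_C_half (V : Type) : (C V (1 / 2 : ℝ)) + C V (1 / 2) = 1 := by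
  unfold C
  rw [← map_add, add_halves, map_one]

/-- The phase `Q/2` modulo one. -/
noncomputable def halfHat {V : Type} : BPoly (ZMod 2) V →+ BPoly ℝ V ⧸ integers V where
  toFun Q := modOne (C _ (1 / 2) * hat Q)
  map_zero' := by rw [hat_zero, mul_zero, map_zero]
  map_add' p q := by
    rw [← map_add, modOne_eq_iff, hat_add]
    -- Half of the correction term in `hat_add` has integer coefficients; hence halved hats are
    -- additive modulo one.
    have h : C V (1 / 2) * (hat p + hat q - 2 * hat p * hat q) -
        (C V (1 / 2) * hat p + C V (1 / 2) * hat q) = -(hat (p * q)) := by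
      rw [hat_mul]
      linear_combination (-hat p * hat q) * C_half_add_C_half V
    rw [h]
    exact neg_mem (isInteger_hat _)

theorem halfHat_apply {V : Type} (Q : BPoly (ZMod 2) V) :
    halfHat Q = modOne (C _ (1 / 2) * hat Q) := rfl

theorem isInteger_rename {V W : Type} (f : V → W) {p : BPoly ℝ V} (h : IsInteger p) :
    IsInteger (rename f p) := by
  unfold IsInteger at *
  induction h using Algebra.adjoin_induction with
  | mem x hx =>
    obtain ⟨v, rfl⟩ := hx
    rw [rename_X]
    exact Algebra.subset_adjoin ⟨_, rfl⟩
  | algebraMap r =>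
    rw [eq_intCast, map_intCast]
    exact intCast_mem _ r
  | add x y _ _ hx hy => rw [map_add]; exact add_mem hx hy
  | mul x y _ _ hx hy => rw [map_mul]; exact mul_mem hx hy

/-- Hats have integer coefficients, so substitution is well defined on phases modulo one. -/
theorem isInteger_substPhase {V W : Type} (σ : V → BPoly (ZMod 2) W) {p : BPoly ℝ V}
    (h : IsInteger p) : IsInteger (substPhase σ p) := by
  unfold IsInteger at *
  induction h using Algebra.adjoin_induction with
  | mem x hx =>
    obtain ⟨v, rfl⟩ := hx
    rw [substPhase, lift_X]
    exact isInteger_hat _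
  | algebraMap r =>
    rw [eq_intCast, map_intCast]
    exact intCast_mem _ r
  | add x y _ _ hx hy => rw [map_add]; exact add_mem hx hy
  | mul x y _ _ hx hy => rw [map_mul]; exact mul_mem hx hy

theorem rename_C {V W : Type} (f : V → W) (r : ℝ) : rename f (C V r) = C W r :=
  AlgHom.commutes _ _

theorem substPhase_C {V W : Type} (σ : V → BPoly (ZMod 2) W) (r : ℝ) :
    substPhase σ (C V r) = C W r :=
  AlgHom.commutes _ _

theorem modOne_rename {V W : Type} (f : V → W) {p : BPoly ℝ V} {Q : BPoly (ZMod 2) V}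
    (h : modOne p = halfHat Q) : modOne (rename f p) = halfHat (rename f Q) := by
  rw [halfHat_apply, modOne_eq_iff] at *
  have := isInteger_rename f h
  rwa [map_sub, map_mul, rename_C, rename_hat] at this

theorem modOne_substPhase {V W : Type} (σ : V → BPoly (ZMod 2) W) {p : BPoly ℝ V}
    {Q : BPoly (ZMod 2) V} (h : modOne p = halfHat Q) :
    modOne (substPhase σ p) = halfHat (subst σ Q) := by
  rw [halfHat_apply, modOne_eq_iff] at *
  have := isInteger_substPhase σ h
  rwa [map_sub, map_mul, substPhase_C, substPhase_hat] at this

/-- Supplies the side conditions of `hhgen`. -/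
theorem notMem_vars_rename {R : Type} [CommRing R] {V W : Type} (f : V → W) (p : BPoly R V)
    {w : W} (hw : ∀ v, f v ≠ w) : w ∉ vars (rename f p) := by
  simp only [vars, Set.mem_ofPred_eq, not_not]
  obtain ⟨p, rfl⟩ := Ideal.Quotient.mk_surjective p
  induction p using MvPolynomial.induction_on with
  | C r =>
    have : (Ideal.Quotient.mk _ (MvPolynomial.C r) : BPoly R V) = algebraMap R _ r := rfl
    rw [this, AlgHom.commutes]
    exact Subalgebra.algebraMap_mem _ r
  | add a b ha hb => rw [map_add, map_add]; exact add_mem ha hb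
  | mul_X a v ha =>
    rw [map_mul, map_mul]
    refine mul_mem ha ?_
    rw [show (Ideal.Quotient.mk _ (MvPolynomial.X v) : BPoly R V) = X R v from rfl, rename_X]
    exact Algebra.subset_adjoin ⟨_, hw v, rfl⟩

/-- Evaluation at zero maps to `ℝ`. The consequence `1 ≠ 0` meets the side condition of rule `z` in
`ofFun_zero`. -/
instance (V : Type) : Nontrivial (BPoly ℝ V) :=
  (lift (R := ℝ) (A := ℝ) (fun _ : V => 0) (by simp)).toRingHom.domain_nontrivial

end BPoly

namespace SOP

open BPoly

/-! ### Terms with phases in `{0, 1/2}`, given by Boolean functions -/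

theorem THEquiv.refl {n m : ℕ} (t : SOP n m) : THEquiv t t := Relation.EqvGen.refl _

theorem THEquiv.symm {n m : ℕ} {t t' : SOP n m} (h : THEquiv t t') : THEquiv t' t :=
  Relation.EqvGen.symm _ _ h

theorem THEquiv.trans {n m : ℕ} {t t' t'' : SOP n m} (h : THEquiv t t') (h' : THEquiv t' t'') :
    THEquiv t t'' :=
  Relation.EqvGen.trans _ _ _ h h'

theorem THEquiv.of_same {n m : ℕ} {t t' : SOP n m} (h : Same t t') : THEquiv t t' :=
  Relation.EqvGen.rel _ _ (Or.inl h)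

theorem THEquiv.of_step {n m : ℕ} {t t' : SOP n m} (h : Step t t') : THEquiv t t' :=
  Relation.EqvGen.rel _ _ (Or.inr h)

theorem THEquiv.of_eq {n m : ℕ} {t t' : SOP n m} (h : t = t') : THEquiv t t' :=
  h ▸ THEquiv.refl t

/-- The data of a term at an assignment: sign, output and input. -/
abbrev Label (n m : ℕ) : Type := ZMod 2 × (Fin m → ZMod 2) × (Fin n → ZMod 2)

/-- The term whose polynomials have the values `A`. -/
noncomputable def ofFun {n m : ℕ} (V : Type) [Finite V] (s : ℝ)
    (A : (V → ZMod 2) → Label n m) : SOP n m where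
  V := V
  s := s
  P := C _ (1 / 2) * hat (poly fun a => (A a).1)
  O := fun j => poly fun a => (A a).2.1 j
  I := fun i => poly fun a => (A a).2.2 i

/-- Outputs and inputs are literally determined by their values; the phase is determined modulo one,
which costs one use of `Same.modOne`. -/
theorem equiv_ofFun {n m : ℕ} {V : Type} [Finite V] {s : ℝ} {P : BPoly ℝ V}
    {O : Fin m → BPoly (ZMod 2) V} {I : Fin n → BPoly (ZMod 2) V} (Φ : BPoly (ZMod 2) V)
    (h : modOne P = halfHat Φ) {A : (V → ZMod 2) → Label n m}
    (hA : ∀ a, A a = (ev a Φ, fun j => ev a (O j), fun i => ev a (I i))) :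
    THEquiv ⟨V, s, P, O, I⟩ (ofFun V s A) := by
  have hΦ : (poly fun a => (A a).1) = Φ := ev_ext fun a => by simp [hA]
  have hO : (fun j => poly fun a => (A a).2.1 j) = O :=
    funext fun j => ev_ext fun a => by simp [hA]
  have hI : (fun j => poly fun a => (A a).2.2 j) = I :=
    funext fun j => ev_ext fun a => by simp [hA]
  unfold ofFun
  rw [hΦ, hO, hI]
  exact .of_same (.modOne _ _ _ _ _ (modOne_eq_iff.mp h))

theorem ofFun_reindex {n m : ℕ} {V W : Type} [Finite V] [Finite W] (e : V ≃ W) (s : ℝ)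
    (A : (V → ZMod 2) → Label n m) :
    THEquiv (ofFun V s A) (ofFun W s fun a => A fun v => a (e v)) := by
  refine .trans (.of_same (.alpha _ e)) ?_
  refine equiv_ofFun (rename e (poly fun a => (A a).1)) (modOne_rename _ rfl) fun a => ?_
  refine Prod.ext ?_ (Prod.ext (funext fun j => ?_) (funext fun i => ?_))
  · exact ((ev_rename e a (poly fun a => (A a).1)).trans (ev_poly _ _)).symm
  · exact ((ev_rename e a (poly fun a => (A a).2.1 j)).trans (ev_poly _ _)).symm
  · exact ((ev_rename e a (poly fun a => (A a).2.2 i)).trans (ev_poly _ _)).symm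

theorem ofFun_elim {n m : ℕ} {W : Type} [Finite W] (s : ℝ) (A : (W → ZMod 2) → Label n m) :
    THEquiv (ofFun (Option W) s fun a => A fun w => a (some w)) (ofFun W (2 * s) A) := by
  refine .trans (.symm ?_) (.of_step (.elim _ _ _ _))
  refine equiv_ofFun (rename some (poly fun a => (A a).1)) (modOne_rename _ rfl) fun a => ?_
  simp

/-- The label with the phase changed by `x`. -/
def Label.bump {n m : ℕ} (x : ZMod 2) (l : Label n m) : Label n m := (x + l.1, l.2)

/-- Evaluation at `Option W` from the value at `none` and the values on `W`. -/
def ext {W : Type} (x : ZMod 2) (a : W → ZMod 2) : Option W → ZMod 2 := fun v => v.elim x a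

/-- Summation over the variable `some none` forces `none` to have the value `p`. -/
theorem ofFun_hh {n m : ℕ} {W : Type} [Finite W] (s : ℝ) (p : (W → ZMod 2) → ZMod 2)
    (A : ZMod 2 → (W → ZMod 2) → Label n m) :
    THEquiv
      (ofFun (Option (Option W)) s fun a =>
        (A (a none) fun w => a (some (some w))).bump
          (a (some none) * (a none + p fun w => a (some (some w)))))
      (ofFun W (2 * s) fun a => A (p a) a) := by
  let B : (Option W → ZMod 2) → Label n m := fun a => A (a none) fun w => a (some w)
  -- The rule substitutes `1 + Q'`, which is then `p`.
  let Q' : BPoly (ZMod 2) (Option W) := 1 + rename some (poly p)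
  let R : BPoly (ZMod 2) (Option W) := poly fun a => (B a).1
  let O : Fin m → BPoly (ZMod 2) (Option W) := fun j => poly fun a => (B a).2.1 j
  let I : Fin n → BPoly (ZMod 2) (Option W) := fun i => poly fun a => (B a).2.2 i
  -- The image of `f` omits `some none`: the remainder, outputs and inputs may involve the variable
  -- to be replaced but not the summed one.
  let f : Option W → Option (Option W) := Option.map some
  have hf : ∀ v, f v ≠ some none := by rintro (_ | _) h <;> simp [f] at h
  let Y : BPoly (ZMod 2) (Option (Option W)) := X _ (some none)
  let Φ : BPoly (ZMod 2) (Option (Option W)) :=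
    Y * X _ none * rename some (1 : BPoly (ZMod 2) (Option W)) + Y * rename some Q' + Y +
      rename f R
  have hΦ : modOne (C _ (1 / 2) * X ℝ (some none) *
      (X ℝ none * rename some (hat (1 : BPoly (ZMod 2) (Option W))) +
        rename some (hat Q') + 1) + rename f (C _ (1 / 2) * hat R)) = halfHat Φ := by
    simp only [Φ, Y, map_add]
    rw [modOne_rename f (Q := R) rfl, ← map_add, ← map_add, halfHat_apply]
    congr 1
    have key : halfHat (Y * X _ none * rename some (1 : BPoly (ZMod 2) (Option W)) +
        Y * rename some Q' + Y) = modOne (C _ (1 / 2) * X ℝ (some none) *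
      (X ℝ none * rename some (hat (1 : BPoly (ZMod 2) (Option W))) +
        rename some (hat Q') + 1)) := by
      rw [map_add, map_add, halfHat_apply, halfHat_apply, halfHat_apply, ← map_add, ← map_add]
      congr 1
      simp only [Y, hat_mul, hat_X, rename_hat]
      ring
    exact key.symm
  refine .trans (.symm (equiv_ofFun Φ hΦ (O := fun j => rename f (O j))
    (I := fun i => rename f (I i)) ?_)) ?_
  · have key : ∀ y z q r : ZMod 2, y * (z + q) + r = y * z + y * (1 + q) + y + r := by decide
    intro a
    simp [Φ, Y, Q', R, O, I, B, f, Label.bump, key]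
  refine .trans (.of_step (.hhgen s none 1 Q' _ _ _ ?_ ?_ ?_ ?_ ?_ (one_mul _))) ?_
  · rw [← map_one (rename (R := ZMod 2) (some : W → Option W))]
    exact notMem_vars_rename _ _ (by simp)
  · simp only [Q']
    rw [← map_one (rename (R := ZMod 2) (some : W → Option W)), ← map_add]
    exact notMem_vars_rename _ _ (by simp)
  · exact notMem_vars_rename _ _ hf
  · exact fun _ => notMem_vars_rename _ _ hf
  · exact fun _ => notMem_vars_rename _ _ hf
  -- After the substitution the coefficient of the summed variable is `p + (1 + p) + 1 = 0`, so this
  -- variable no longer occurs and `elim` removes it, doubling the scalar.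
  refine .trans (equiv_ofFun _ (modOne_substPhase _ hΦ)
    (A := fun a => A (p fun w => a (some w)) fun w => a (some w)) ?_) (ofFun_elim s fun a => A (p a) a)
  have key : ∀ y q : ZMod 2, y * q + y * (1 + q) + y = 0 := by decide
  have key2 : ∀ q : ZMod 2, 1 + (1 + q) = q := by decide
  intro a
  refine Prod.ext ?_ (Prod.ext (funext fun j => ?_) (funext fun i => ?_))
  · simp [Φ, Y, Q', R, B, f, key2, key]
  · simp [Q', O, B, f, key2]
  · simp [Q', I, B, f, key2]

/-! ### Invariance under permutations of the assignments -/

/-- Let `x` be the variable `none`. Introduce `z` forced to equal `x + g`. The constraint `z + x + g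
= 0` is symmetric in `z` and `x`, so after exchanging their names it can be used to remove the old
variable instead of the new one. -/
theorem ofFun_shear {n m : ℕ} {W : Type} [Finite W] (s : ℝ) (g : (W → ZMod 2) → ZMod 2)
    (A : (Option W → ZMod 2) → Label n m) :
    THEquiv (ofFun (Option W) s A)
      (ofFun (Option W) s fun a =>
        A (ext (a none + g fun w => a (some w)) fun w => a (some w))) := by
  have h₁ := ofFun_hh (s / 2) (fun a : Option W → ZMod 2 => a none + g fun w => a (some w))
    (fun _ a => A a)
  have h₂ := ofFun_hh (s / 2) (fun a : Option W → ZMod 2 => a none + g fun w => a (some w))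
    (fun y a => A (ext y fun w => a (some w)))
  rw [mul_div_cancel₀ s two_ne_zero] at h₁ h₂
  refine h₁.symm.trans (.trans ?_ h₂)
  classical
  -- Here `none` is the new variable, `some (some none)` the old one, and `some none` the summed
  -- variable that imposes the constraint.
  refine (ofFun_reindex (Equiv.swap none (some (some none))) _ _).trans (.of_eq ?_)
  congr 1
  funext a
  have e₁ : ∀ w : W, Equiv.swap (none : Option (Option (Option W))) (some (some none))
    (some (some (some w))) = some (some (some w)) := fun w =>
    Equiv.swap_apply_of_ne_of_ne (by simp) (by simp)
  have e₂ : Equiv.swap (none : Option (Option (Option W))) (some (some none))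
    (some none) = some none := Equiv.swap_apply_of_ne_of_ne (by simp) (by simp)
  have e₃ : (fun w : Option W => a (Equiv.swap (none : Option (Option (Option W)))
      (some (some none)) (some (some w)))) = ext (a none) fun w => a (some (some (some w))) := by
    funext w
    cases w
    · simp [ext]
    · simp [ext, e₁]
  have key : ∀ x y z : ZMod 2, x + (y + z) = y + (x + z) := by decide
  simp only [e₁, e₂, e₃, Equiv.swap_apply_left, Equiv.swap_apply_right, key]

/-- This transposition flips coordinate `k` exactly when all other coordinates agree with `a`: it is
a shear along `k` whose control is an indicator function. -/
theorem ofFun_swap_update {n m : ℕ} {V : Type} [Finite V] [DecidableEq V] (s : ℝ)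
    (A : (V → ZMod 2) → Label n m) (a : V → ZMod 2) (k : V) [DecidableEq (V → ZMod 2)] :
    THEquiv (ofFun V s A)
      (ofFun V s fun b => A (Equiv.swap a (Function.update a k (a k + 1)) b)) := by
  let e : V ≃ Option {v // v ≠ k} := (Equiv.optionSubtypeNe k).symm
  have hek : e k = none := by simp [e]
  have hes : ∀ w : {v // v ≠ k}, e w = some w := by
    intro w
    simp [e, w.2]
  classical
  let g : ({v // v ≠ k} → ZMod 2) → ZMod 2 := fun b => if b = fun w => a w.1 then 1 else 0
  refine (ofFun_reindex e s A).trans ((ofFun_shear s g _).trans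
    ((ofFun_reindex e.symm s _).trans (.of_eq ?_)))
  congr 1
  funext b
  congr 1
  have hn : e.symm none = k := by rw [← hek, e.symm_apply_apply]
  have hs : ∀ w : {v // v ≠ k}, e.symm (some w) = w := fun w => by
    rw [← hes, e.symm_apply_apply]
  funext v
  simp only [hn, hs]
  have hk2 : ∀ x y : ZMod 2, x ≠ y → x = y + 1 := by decide
  have hk3 : ∀ x : ZMod 2, x + 1 + 1 = x := by decide
  by_cases hb : ∀ w, w ≠ k → b w = a w
  · have hg : (g fun w => b w.1) = 1 := if_pos (funext fun w : {v // v ≠ k} => hb w.1 w.2)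
    rw [hg]
    have hbu : ∀ x, b k = x → b = Function.update a k x := by
      intro x hx
      funext w
      by_cases hw : w = k
      · subst hw; simp [hx]
      · simp [hw, hb w hw]
    by_cases hbk : b k = a k
    · have hba : b = a := by rw [hbu _ hbk, Function.update_eq_self]
      rw [hba, Equiv.swap_apply_left]
      by_cases hv : v = k
      · subst hv; simp [hek, ext]
      · have := hes ⟨v, hv⟩
        simp only at this
        simp [this, ext, hv]
    · have hb1 := hk2 _ _ hbk
      have hba := hbu _ hb1
      rw [hba, Equiv.swap_apply_right]
      by_cases hv : v = k
      · subst hv; simp [hek, ext, hk3]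
      · have := hes ⟨v, hv⟩
        simp only at this
        simp [this, ext, hv]
  · have hg : (g fun w => b w.1) = 0 := by
      refine if_neg fun h => hb fun w hw => ?_
      exact congrFun h ⟨w, hw⟩
    push Not at hb
    obtain ⟨w, hw, hbw⟩ := hb
    rw [hg, Equiv.swap_apply_of_ne_of_ne]
    · by_cases hv : v = k
      · subst hv; simp [hek, ext]
      · have := hes ⟨v, hv⟩
        simp only at this
        simp [this, ext]
    · rintro rfl
      exact hbw rfl
    · rintro rfl
      exact hbw (by simp [hw])

theorem ofFun_perm {n m : ℕ} {V : Type} [Finite V] (s : ℝ) (σ : Equiv.Perm (V → ZMod 2))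
    (A : (V → ZMod 2) → Label n m) :
    THEquiv (ofFun V s A) (ofFun V s fun a => A (σ a)) := by
  classical
  -- The admissible permutations form a submonoid, and transpositions generate all permutations as a
  -- monoid.
  let M : Submonoid (Equiv.Perm (V → ZMod 2)) :=
    { carrier := {σ | ∀ A : (V → ZMod 2) → Label n m,
        THEquiv (ofFun V s A) (ofFun V s fun a => A (σ a))}
      one_mem' := fun A => .refl _
      mul_mem' := fun {σ τ} hσ hτ A => (hσ A).trans (hτ fun a => A (σ a)) }
  suffices h : M = ⊤ by
    have : σ ∈ M := h ▸ Submonoid.mem_top σ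
    exact this A
  rw [eq_top_iff, ← Equiv.Perm.mclosure_isSwap, Submonoid.closure_le]
  rintro _ ⟨a, b, -, rfl⟩
  -- Walk from `a` to `b` one coordinate at a time; transpositions along consecutive points compose
  -- to the transposition of the endpoints.
  have key : ∀ S : Finset V, Equiv.swap a (fun v => if v ∈ S then b v else a v) ∈ M := by
    intro S
    induction S using Finset.induction_on with
    | empty => simp only [Finset.notMem_empty, if_false, Equiv.swap_self]; exact M.one_mem
    | insert k S hk ih =>
      set c : V → ZMod 2 := fun v => if v ∈ S then b v else a v with hc
      have hck : c k = a k := by simp [hc, hk]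
      have hn : (fun v => if v ∈ insert k S then b v else a v) = Function.update c k (b k) := by
        funext v
        by_cases hv : v = k
        · subst hv; simp
        · simp [hv, hc]
      rw [hn]
      have h2 : ∀ x y : ZMod 2, x = y ∨ x = y + 1 := by decide
      rcases h2 (b k) (c k) with h | h
      · rw [h, Function.update_eq_self]
        exact ih
      · rw [h]
        exact SubmonoidClass.swap_mem_trans M ih fun A => ofFun_swap_update s A c k
  have := Fintype.ofFinite V
  simpa using key Finset.univ

/-- Functions with equinumerous fibres differ by a permutation of their domain. -/
theorem ofFun_of_card {n m : ℕ} {V : Type} [Finite V] (s : ℝ)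
    {A B : (V → ZMod 2) → Label n m}
    (h : ∀ l, Nat.card {a // A a = l} = Nat.card {a // B a = l}) :
    THEquiv (ofFun V s A) (ofFun V s B) := by
  have e : ∀ l, {a // B a = l} ≃ {a // A a = l} := fun l =>
    (Finite.card_eq.mp (h l).symm).some
  refine (ofFun_perm s (Equiv.ofFiberEquiv e) A).trans (.of_eq ?_)
  congr 1
  funext a
  exact Equiv.ofFiberEquiv_map e a

end SOP

namespace SOP

open BPoly

/-! ### Completeness of the rewrite steps -/

/-- The number of assignments with label `l`. -/
noncomputable def count {n m : ℕ} {V : Type} (A : (V → ZMod 2) → Label n m) (l : Label n m) : ℕ :=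
  Nat.card {a // A a = l}

/-- The signed number of assignments with output and input `l`. -/
noncomputable def net {n m : ℕ} {V : Type} (A : (V → ZMod 2) → Label n m)
    (l : (Fin m → ZMod 2) × (Fin n → ZMod 2)) : ℤ :=
  count A (0, l) - count A (1, l)

theorem count_eq_sum {n m : ℕ} {V : Type} [Fintype V] [DecidableEq V]
    (A : (V → ZMod 2) → Label n m) (l : Label n m) :
    count A l = ∑ a, if A a = l then 1 else 0 := by
  rw [count, Nat.card_eq_fintype_card, Fintype.card_subtype, Finset.card_filter]

theorem sum_zmod_two {M : Type*} [AddCommMonoid M] (f : ZMod 2 → M) : ∑ x, f x = f 0 + f 1 :=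
  Fin.sum_univ_two f

theorem sum_option {M : Type*} [AddCommMonoid M] {V : Type} [Fintype V] [DecidableEq V]
    (f : (Option V → ZMod 2) → M) : ∑ a, f a = ∑ a, (f (ext 0 a) + f (ext 1 a)) := by
  have e : ∀ p : ZMod 2 × (V → ZMod 2),
      (Equiv.piOptionEquivProd (β := fun _ : Option V => ZMod 2)).symm p = ext p.1 p.2 := by
    intro p
    funext v
    cases v <;> rfl
  rw [← Equiv.sum_comp (Equiv.piOptionEquivProd (β := fun _ : Option V => ZMod 2)).symm,
    Fintype.sum_prod_type, sum_zmod_two, ← Finset.sum_add_distrib]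
  simp only [e]

theorem count_comp {n m : ℕ} {V W : Type} (e : (W → ZMod 2) ≃ (V → ZMod 2))
    (A : (V → ZMod 2) → Label n m) (l : Label n m) : count (fun a => A (e a)) l = count A l :=
  Nat.card_congr (e.subtypeEquiv fun _ => Iff.rfl)

theorem net_reindex {n m : ℕ} {V W : Type} (e : V ≃ W) (A : (V → ZMod 2) → Label n m) :
    net (fun a : W → ZMod 2 => A fun v => a (e v)) = net A := by
  funext l
  have h := count_comp (e.arrowCongr (Equiv.refl (ZMod 2))).symm A
  exact congrArg₂ (fun x y : ℕ => (x : ℤ) - y) (h _) (h _)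

theorem net_elim {n m : ℕ} {V : Type} [Finite V] (A : (V → ZMod 2) → Label n m)
    (l : (Fin m → ZMod 2) × (Fin n → ZMod 2)) :
    net (fun a : Option V → ZMod 2 => A fun v => a (some v)) l = 2 * net A l := by
  classical
  have := Fintype.ofFinite V
  have h : ∀ l, count (fun a : Option V → ZMod 2 => A fun v => a (some v)) l = 2 * count A l := by
    intro l
    rw [count_eq_sum, count_eq_sum, sum_option, Finset.mul_sum]
    refine Finset.sum_congr rfl fun a _ => ?_
    rw [two_mul]
    rfl
  rw [net, net, h, h]
  push_cast
  ring

/-- Twice `A`, with `B` in both signs. -/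
def double {n m : ℕ} {V : Type} (A B : (V → ZMod 2) → Label n m) :
    (Option (Option V) → ZMod 2) → Label n m := fun a =>
  (if a none = 0 then A fun w => a (some (some w)) else B fun w => a (some (some w))).bump
    (a (some none) * a none)

/-- Introduce a variable forced to be `0`. Its branch at `1` cancels, so an arbitrary `B` may be
placed there. -/
theorem ofFun_double {n m : ℕ} {V : Type} [Finite V] (s : ℝ) (A B : (V → ZMod 2) → Label n m) :
    THEquiv (ofFun V s A) (ofFun (Option (Option V)) (s / 2) (double A B)) := by
  have h := ofFun_hh (s / 2) (fun _ => 0) fun x (a : V → ZMod 2) => if x = 0 then A a else B a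
  rw [mul_div_cancel₀ s two_ne_zero] at h
  simp only [add_zero, if_true] at h
  exact h.symm

theorem count_double {n m : ℕ} {V : Type} [Finite V] (A B : (V → ZMod 2) → Label n m)
    (x : ZMod 2) (l : (Fin m → ZMod 2) × (Fin n → ZMod 2)) :
    count (double A B) (x, l) = 2 * count A (x, l) + count B (x, l) + count B (x + 1, l) := by
  classical
  have := Fintype.ofFinite V
  simp only [count_eq_sum, sum_option, Finset.mul_sum, ← Finset.sum_add_distrib]
  refine Finset.sum_congr rfl fun a _ => ?_
  have h : ∀ y : ZMod 2, 1 + y = x ↔ y = x + 1 := by revert x; decide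
  simp only [double, ext, Option.elim, Label.bump, Prod.ext_iff]
  simp only [h, one_ne_zero, if_true, if_false, mul_zero, mul_one, zero_add]
  eta_reduce
  ring

theorem net_double {n m : ℕ} {V : Type} [Finite V] (A B : (V → ZMod 2) → Label n m)
    (l : (Fin m → ZMod 2) × (Fin n → ZMod 2)) : net (double A B) l = 2 * net A l := by
  rw [net, net, count_double, count_double, zero_add, show (1 + 1 : ZMod 2) = 0 from rfl]
  push_cast
  ring

/-- With `A₀, A₁` and `B₀, B₁` the counts by sign, `double A B` has counts `2 Aₓ + B₀ + B₁` and
`double B A` has `2 Bₓ + A₀ + A₁`. These agree for both signs exactly when `A₀ - A₁ = B₀ - B₁`. -/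
theorem ofFun_of_net {n m : ℕ} {V : Type} [Finite V] (s : ℝ)
    {A B : (V → ZMod 2) → Label n m} (h : net A = net B) :
    THEquiv (ofFun V s A) (ofFun V s B) := by
  refine (ofFun_double s A B).trans (.trans (ofFun_of_card _ ?_) (ofFun_double s B A).symm)
  rintro ⟨x, l⟩
  have hl := congrFun h l
  rw [net, net] at hl
  have h2 : ∀ x : ZMod 2, x = 0 ∨ x = 1 := by decide
  change count _ _ = count _ _
  rw [count_double, count_double]
  rcases h2 x with rfl | rfl
  · rw [zero_add]; lia
  · rw [show (1 + 1 : ZMod 2) = 0 from rfl]; lia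

/-- The scalar can be halved at the price of one variable (`elim` reversed) or of two (`double`), so
`c` halvings reach any number of variables in the given range. This makes scalar and number of
variables adjustable independently. -/
theorem ofFun_pad {n m : ℕ} {V : Type} [Finite V] (s : ℝ) (A : (V → ZMod 2) → Label n m)
    (c N : ℕ) (h₁ : Nat.card V + c ≤ N) (h₂ : N ≤ Nat.card V + 2 * c) :
    ∃ B : (Fin N → ZMod 2) → Label n m,
      THEquiv (ofFun V s A) (ofFun (Fin N) (s / 2 ^ c) B) ∧ ∀ l, net B l = 2 ^ c * net A l := by
  induction c generalizing N with
  | zero =>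
    obtain rfl : N = Nat.card V := by lia
    refine ⟨fun a => A fun v => a (Finite.equivFin V v), ?_, ?_⟩
    · rw [pow_zero, div_one]
      exact ofFun_reindex _ s A
    · rw [net_reindex]
      simp
  | succ c ih =>
    have hs : s / 2 ^ (c + 1) = s / 2 ^ c / 2 := by rw [pow_succ, div_mul_eq_div_div]
    rw [hs]
    -- Spend one variable when this leaves a number within reach of `c` halvings; otherwise `N` is
    -- the upper bound and two are spent.
    by_cases hN : N ≤ Nat.card V + 2 * c + 1
    · obtain ⟨M, rfl⟩ : ∃ M, N = M + 1 := ⟨N - 1, by lia⟩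
      obtain ⟨B, hB, hn⟩ := ih M (by lia) (by lia)
      have h := ofFun_elim (s / 2 ^ c / 2) B
      rw [mul_div_cancel₀ _ two_ne_zero] at h
      refine ⟨_, hB.trans (h.symm.trans (ofFun_reindex (finSuccEquiv M).symm _ _)), fun l => ?_⟩
      rw [net_reindex (finSuccEquiv M).symm fun a => B fun w => a (some w), net_elim, hn]
      ring
    · obtain ⟨M, rfl⟩ : ∃ M, N = M + 2 := ⟨N - 2, by lia⟩
      obtain ⟨B, hB, hn⟩ := ih M (by lia) (by lia)
      let e : Option (Option (Fin M)) ≃ Fin (M + 2) :=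
        (finSuccEquiv M).symm.optionCongr.trans (finSuccEquiv (M + 1)).symm
      refine ⟨_, hB.trans ((ofFun_double _ B B).trans (ofFun_reindex e _ _)), fun l => ?_⟩
      rw [net_reindex, net_double, hn]
      ring

/-- The normal form of the terms with value zero. -/
noncomputable def zeroTerm (n m : ℕ) : SOP n m :=
  ⟨Unit, 1, C _ (1 / 2) * X ℝ (), fun _ => 0, fun _ => 0⟩

/-- With one extra variable there is a comparison term of net zero whose sign is that variable and
whose outputs and inputs vanish; rule `z` applies to it and resets the scalar to `1`. -/
theorem ofFun_zero {n m : ℕ} {V : Type} [Finite V] (s : ℝ) (A : (V → ZMod 2) → Label n m)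
    (h : net A = 0) : THEquiv (ofFun V s A) (zeroTerm n m) := by
  have h₁ := ofFun_elim (s / 2) A
  rw [mul_div_cancel₀ _ two_ne_zero] at h₁
  refine h₁.symm.trans (.trans (ofFun_of_net _ (B := fun a => (a none, 0, 0)) ?_) ?_)
  · funext l
    classical
    have := Fintype.ofFinite V
    have e : count (fun a : Option V → ZMod 2 => ((a none, 0, 0) : Label n m)) (0, l) =
        count (fun a : Option V → ZMod 2 => ((a none, 0, 0) : Label n m)) (1, l) := by
      rw [count_eq_sum, count_eq_sum, sum_option, sum_option]
      refine Finset.sum_congr rfl fun a _ => ?_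
      simp [ext, Prod.ext_iff]
    rw [net_elim, h, net, e]
    simp
  -- The remainder `R = 1` is trivial modulo one but not zero, as rule `z` demands.
  · refine .trans (.symm (equiv_ofFun (P := C _ (1 / 2) * X ℝ none + rename some 1)
      (O := fun _ => rename some 0) (I := fun _ => rename some 0) (X _ none) ?_ ?_))
      (.of_step (.z (s / 2) (1 : BPoly ℝ V) (fun _ => 0) (fun _ => 0) (Or.inl one_ne_zero)))
    · rw [halfHat_apply, hat_X, modOne_eq_iff, add_sub_cancel_left]
      exact isInteger_rename _ (one_mem _)
    · intro a
      simp only [map_zero, ev_X]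
      rfl

/-- An odd `j` would make `√2` rational. -/
theorem zpow_sqrt_two_eq {j : ℤ} {a b : ℤ} (ha : a ≠ 0) (h : √2 ^ j * a = b) :
    ∃ i : ℤ, j = 2 * i := by
  rcases Int.even_or_odd' j with ⟨i, hi | hi⟩
  · exact ⟨i, hi⟩
  · exfalso
    have h2 : (√2 : ℝ) ≠ 0 := by positivity
    have hsq : (√2 : ℝ) ^ (2 : ℤ) = 2 := by
      rw [zpow_ofNat]
      exact Real.sq_sqrt (by norm_num)
    rw [hi, zpow_add₀ h2, zpow_mul, hsq, zpow_one] at h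
    refine irrational_sqrt_two ⟨b / (2 ^ i * a), ?_⟩
    push_cast
    rw [← h]
    have ha' : (a : ℝ) ≠ 0 := by exact_mod_cast ha
    have hi' : (2 : ℝ) ^ i ≠ 0 := by positivity
    field_simp

/-- If some entry is nonzero, the ratio of the scalars is rational, hence a power of `2`. Padding
then gives both terms the same scalar and variables, and equal matrices mean equal net numbers. -/
theorem ofFun_complete {n m : ℕ} {V W : Type} [Finite V] [Finite W] {j k : ℤ}
    {A : (V → ZMod 2) → Label n m} {B : (W → ZMod 2) → Label n m}
    (h : ∀ l, √2 ^ j * (net A l : ℝ) = √2 ^ k * net B l) :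
    THEquiv (ofFun V (√2 ^ j) A) (ofFun W (√2 ^ k) B) := by
  have h2 : (√2 : ℝ) ≠ 0 := by positivity
  have hj := zpow_ne_zero j h2
  have hk := zpow_ne_zero k h2
  by_cases hA : net A = 0
  · have hB : net B = 0 := by
      funext l
      have := h l
      rw [hA] at this
      simpa [hk] using this.symm
    exact (ofFun_zero _ _ hA).trans (ofFun_zero _ _ hB).symm
  · obtain ⟨l, hl⟩ := Function.ne_iff.mp hA
    have hjk : √2 ^ (j - k) * (net A l : ℝ) = net B l := by
      rw [zpow_sub₀ h2, div_mul_eq_mul_div, h l, mul_div_cancel_left₀ _ hk]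
    obtain ⟨i, hi⟩ := zpow_sqrt_two_eq hl hjk
    have hs : √2 ^ j = √2 ^ k * (2 : ℝ) ^ i := by
      have hsq : (√2 : ℝ) ^ (2 : ℤ) = 2 := by
        rw [zpow_ofNat]
        exact Real.sq_sqrt (by norm_num)
      rw [show j = k + 2 * i by lia, zpow_add₀ h2, zpow_mul, hsq]
    obtain ⟨p, q, rfl⟩ : ∃ p q : ℕ, i = p - q := ⟨i.toNat, (-i).toNat, by lia⟩
    -- Halving `c + p` and `c + q` times equalises the scalars, whose ratio is `2 ^ (p - q)`; this
    -- `c` is large enough for a common number of variables to lie in both ranges of `ofFun_pad`.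
    let c := Nat.card V + Nat.card W + p + q
    obtain ⟨A', hA', hnA⟩ := ofFun_pad (√2 ^ j) A (c + p)
      (Nat.card V + Nat.card W + c + p + q) (by lia) (by lia)
    obtain ⟨B', hB', hnB⟩ := ofFun_pad (√2 ^ k) B (c + q)
      (Nat.card V + Nat.card W + c + p + q) (by lia) (by lia)
    clear_value c
    have hss : √2 ^ j / 2 ^ (c + p) = √2 ^ k / 2 ^ (c + q) := by
      rw [hs, zpow_sub₀ two_ne_zero, zpow_natCast, zpow_natCast, pow_add, pow_add]
      field_simp
    rw [hss] at hA'
    refine hA'.trans ((ofFun_of_net _ ?_).trans hB'.symm)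
    funext l
    have hl : (√2 ^ k / 2 ^ (c + q)) * (net A' l : ℝ) = (√2 ^ k / 2 ^ (c + q)) * net B' l := by
      rw [hnB, ← hss, hnA]
      push_cast
      rw [hss, ← mul_assoc, ← mul_assoc, div_mul_cancel₀ _ (by positivity), ← h l, ← hss,
        div_mul_cancel₀ _ (by positivity)]
    exact_mod_cast mul_left_cancel₀ (div_ne_zero hk (by positivity)) hl

end SOP

/-! ### Matrix semantics -/

/-- The sign `(-1) ^ x`. -/
noncomputable def sgn (x : ZMod 2) : ℝ := if x = 0 then 1 else -1

theorem sgn_zero : sgn 0 = 1 := if_pos rfl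

theorem sgn_one : sgn 1 = -1 := if_neg one_ne_zero

theorem sgn_add (x y : ZMod 2) : sgn (x + y) = sgn x * sgn y := by
  have h2 : ∀ x : ZMod 2, x = 0 ∨ x = 1 := by decide
  rcases h2 x with rfl | rfl <;> rcases h2 y with rfl | rfl <;>
    simp [sgn_zero, sgn_one, show (1 + 1 : ZMod 2) = 0 from rfl]

theorem sgn_sum {ι : Type*} (S : Finset ι) (f : ι → ZMod 2) :
    sgn (∑ k ∈ S, f k) = ∏ k ∈ S, sgn (f k) := by
  classical
  induction S using Finset.induction_on with
  | empty => simp [sgn_zero]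
  | insert k S hk ih => rw [Finset.sum_insert hk, Finset.prod_insert hk, sgn_add, ih]

/-- The Kronecker delta. -/
noncomputable def kron {α : Type*} [DecidableEq α] (x y : α) : ℝ := if x = y then 1 else 0

theorem kron_self {α : Type*} [DecidableEq α] (x : α) : kron x x = 1 := if_pos rfl

theorem kron_comm {α : Type*} [DecidableEq α] (x y : α) : kron x y = kron y x := by
  simp only [kron, eq_comm]

theorem kron_of_subsingleton {α : Type*} [DecidableEq α] [Subsingleton α] (x y : α) :
    kron x y = 1 :=
  if_pos (Subsingleton.elim x y)

theorem kron_congr {α β : Type*} [DecidableEq α] [DecidableEq β] {x y : α} {z w : β}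
    (h : x = y ↔ z = w) : kron x y = kron z w := by
  simp only [kron, h]

theorem sum_kron_mul {α : Type*} [Fintype α] [DecidableEq α] (a : α) (F : α → ℝ) :
    ∑ x, kron a x * F x = F a := by
  simp [kron]

theorem sum_mul_kron {α : Type*} [Fintype α] [DecidableEq α] (a : α) (F : α → ℝ) :
    ∑ x, F x * kron x a = F a := by
  simp [kron]

theorem sum_kron_mul' {α : Type*} [Fintype α] [DecidableEq α] (a : α) (F : α → ℝ) :
    ∑ x, kron x a * F x = F a := by
  simp [kron]

theorem sum_mul_kron' {α : Type*} [Fintype α] [DecidableEq α] (a : α) (F : α → ℝ) :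
    ∑ x, F x * kron a x = F a := by
  simp [kron]

theorem kron_pi {ι : Type*} [Fintype ι] [DecidableEq ι] (u w : ι → ZMod 2) :
    kron u w = ∏ k, kron (u k) (w k) := by
  simp only [kron]
  rw [Finset.prod_boole]
  simp [funext_iff]

theorem kron_append {a b : ℕ} (u u' : Fin a → ZMod 2) (v v' : Fin b → ZMod 2) :
    kron (Fin.append u v) (Fin.append u' v') = kron u u' * kron v v' := by
  simp [kron_pi, Fin.prod_univ_add]

theorem sum_append {M : Type*} [AddCommMonoid M] {a b : ℕ} (F : (Fin (a + b) → ZMod 2) → M) :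
    ∑ x, F x = ∑ u, ∑ v, F (Fin.append u v) := by
  rw [← Equiv.sum_comp (Fin.appendEquiv a b), Fintype.sum_prod_type]
  rfl

theorem sum_sumElim {M : Type*} [AddCommMonoid M] {V W : Type} [Fintype V] [Fintype W]
    [DecidableEq V] [DecidableEq W] (F : (V ⊕ W → ZMod 2) → M) :
    ∑ x, F x = ∑ u, ∑ v, F (Sum.elim u v) := by
  rw [← Equiv.sum_comp (Equiv.sumArrowEquivProdArrow V W (ZMod 2)).symm, Fintype.sum_prod_type]
  rfl

theorem sum_unique {M : Type*} [AddCommMonoid M] {ι : Type} [Fintype ι] [DecidableEq ι] [Unique ι]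
    (F : (ι → ZMod 2) → M) : ∑ x, F x = ∑ b, F fun _ => b := by
  rw [← Equiv.sum_comp (Equiv.funUnique ι (ZMod 2)).symm]
  rfl

/-- Orthogonality of characters: the sum factors over the coordinates. -/
theorem sum_sgn_linear {ι : Type} [Fintype ι] [DecidableEq ι] (w : ι → ZMod 2) :
    ∑ y : ι → ZMod 2, sgn (∑ k, w k * y k) = 2 ^ Fintype.card ι * kron w 0 := by
  have h : ∀ x : ZMod 2, ∑ y, sgn (x * y) = 2 * kron x 0 := by
    have h2 : ∀ x : ZMod 2, x = 0 ∨ x = 1 := by decide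
    intro x
    rw [SOP.sum_zmod_two]
    rcases h2 x with rfl | rfl
    · simp [sgn_zero, kron]; norm_num
    · simp [sgn_zero, sgn_one, kron]
  simp only [sgn_sum]
  have := Finset.prod_univ_sum (fun _ : ι => (Finset.univ : Finset (ZMod 2)))
    (fun k x => sgn (w k * x))
  rw [Fintype.piFinset_univ] at this
  rw [← this, kron_pi]
  simp only [h, Finset.prod_mul_distrib, Finset.prod_const, Finset.card_univ, Pi.zero_apply]

/-- Real matrices, indexed by Boolean vectors. -/
abbrev Mat (n m : ℕ) : Type := (Fin m → ZMod 2) → (Fin n → ZMod 2) → ℝ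

namespace ZHTH

/-- The matrix that a diagram denotes. -/
noncomputable def sem : {n m : ℕ} → ZHTH n m → Mat n m
  | _, _, Z _ _ => fun o i => ∑ b : ZMod 2, kron o (fun _ => b) * kron i fun _ => b
  | _, _, H _ _ => fun o i => sgn ((∏ k, i k) * ∏ k, o k)
  | _, _, sqrtHalf => fun _ _ => 1 / √2
  | _, _, id _ => fun o i => kron o i
  | _, _, swap n m => fun o i =>
      kron o (Fin.append (fun k => i (Fin.natAdd n k)) fun k => i (Fin.castAdd m k))
  | _, _, cup n => fun o _ => kron (fun k => o (Fin.castAdd n k)) fun k => o (Fin.natAdd n k)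
  | _, _, cap n => fun _ i => kron (fun k => i (Fin.castAdd n k)) fun k => i (Fin.natAdd n k)
  | _, _, comp f g => fun o i => ∑ x, f.sem o x * g.sem x i
  | _, _, @tensor n m n' m' f g => fun o i =>
      f.sem (fun k => o (Fin.castAdd m' k)) (fun k => i (Fin.castAdd n' k)) *
        g.sem (fun k => o (Fin.natAdd m k)) (fun k => i (Fin.natAdd n k))

end ZHTH

/-! ### The matrix of a sum-over-paths. -/

namespace SOP

open BPoly

theorem net_eq_sum {n m : ℕ} {V : Type} [Fintype V] [DecidableEq V]
    (A : (V → ZMod 2) → Label n m) (o : Fin m → ZMod 2) (i : Fin n → ZMod 2) :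
    (net A (o, i) : ℝ) = ∑ a, sgn (A a).1 * (kron (A a).2.1 o * kron (A a).2.2 i) := by
  rw [net, count_eq_sum, count_eq_sum]
  push_cast
  rw [← Finset.sum_sub_distrib]
  refine Finset.sum_congr rfl fun a _ => ?_
  obtain ⟨x, p, q⟩ := A a
  have h2 : ∀ x : ZMod 2, x = 0 ∨ x = 1 := by decide
  by_cases hp : p = o <;> by_cases hq : q = i <;> rcases h2 x with rfl | rfl <;>
    simp [kron, hp, hq, sgn_zero, sgn_one]

/-- The values of a term with phase `Φ / 2`. -/
noncomputable def values {n m : ℕ} (t : SOP n m) (Φ : BPoly (ZMod 2) t.V) :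
    (t.V → ZMod 2) → Label n m :=
  fun a => (ev a Φ, fun j => ev a (t.O j), fun i => ev a (t.I i))

/-- The term `t` has a phase in `{0, 1/2}`, its scalar is a power of `√2`, and it denotes `M`. -/
def Denotes {n m : ℕ} (t : SOP n m) (M : Mat n m) : Prop :=
  ∃ (Φ : BPoly (ZMod 2) t.V) (k : ℤ), modOne t.P = halfHat Φ ∧ t.s = √2 ^ k ∧
    ∀ o i, M o i = t.s * net (t.values Φ) (o, i)

theorem Denotes.equiv {n m : ℕ} {t t' : SOP n m} {M : Mat n m}
    (h : t.Denotes M) (h' : t'.Denotes M) : THEquiv t t' := by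
  obtain ⟨Φ, k, hΦ, hk, hM⟩ := h
  obtain ⟨Φ', k', hΦ', hk', hM'⟩ := h'
  have e₁ : THEquiv t (ofFun t.V t.s (t.values Φ)) := equiv_ofFun Φ hΦ fun _ => rfl
  have e₂ : THEquiv t' (ofFun t'.V t'.s (t'.values Φ')) := equiv_ofFun Φ' hΦ' fun _ => rfl
  refine e₁.trans (.trans ?_ e₂.symm)
  rw [hk, hk']
  refine ofFun_complete fun l => ?_
  rw [← hk, ← hk', ← hM, ← hM']

theorem Denotes.intro {n m : ℕ} {V : Type} [Fintype V] [DecidableEq V] {s : ℝ} {P : BPoly ℝ V}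
    {O : Fin m → BPoly (ZMod 2) V} {I : Fin n → BPoly (ZMod 2) V} {M : Mat n m}
    (Φ : BPoly (ZMod 2) V) (k : ℤ) (hP : modOne P = halfHat Φ) (hs : s = √2 ^ k)
    (h : ∀ o i, M o i = s * ∑ a : V → ZMod 2,
      sgn (ev a Φ) * (kron (fun j => ev a (O j)) o * kron (fun j => ev a (I j)) i)) :
    Denotes ⟨V, s, P, O, I⟩ M :=
  ⟨Φ, k, hP, hs, fun o i => (h o i).trans (congrArg (s * ·) (net_eq_sum
    (fun a => (ev a Φ, (fun j => ev a (O j)), fun j => ev a (I j))) o i).symm)⟩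

theorem Denotes.intro_zero {n m : ℕ} {V : Type} [Fintype V] [DecidableEq V]
    {O : Fin m → BPoly (ZMod 2) V} {I : Fin n → BPoly (ZMod 2) V} {M : Mat n m}
    (h : ∀ o i, M o i = ∑ a : V → ZMod 2,
      kron (fun j => ev a (O j)) o * kron (fun j => ev a (I j)) i) :
    Denotes ⟨V, 1, 0, O, I⟩ M :=
  .intro 0 0 (by rw [map_zero, map_zero]) (zpow_zero _).symm fun o i => by simp [h, sgn_zero]

theorem ev_append {V : Type} {a b : ℕ} (x : V → ZMod 2) (p : Fin a → BPoly (ZMod 2) V)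
    (q : Fin b → BPoly (ZMod 2) V) : (fun j => ev x (Fin.append p q j)) =
      Fin.append (fun j => ev x (p j)) fun j => ev x (q j) := by
  funext k
  refine Fin.addCases (fun k => ?_) (fun k => ?_) k <;> simp

theorem Denotes.tensor {n m n' m' : ℕ} {f : SOP n m} {g : SOP n' m'} {M : Mat n m}
    {N : Mat n' m'} (hf : f.Denotes M) (hg : g.Denotes N) :
    (f.tensor g).Denotes fun o i =>
      M (fun k => o (Fin.castAdd m' k)) (fun k => i (Fin.castAdd n' k)) *
        N (fun k => o (Fin.natAdd m k)) (fun k => i (Fin.natAdd n k)) := by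
  obtain ⟨Φ, j, hΦ, hj, hM⟩ := hf
  obtain ⟨Ψ, k, hΨ, hk, hN⟩ := hg
  classical
  have := Fintype.ofFinite f.V
  have := Fintype.ofFinite g.V
  refine .intro (V := f.V ⊕ g.V) (rename Sum.inr Ψ + rename Sum.inl Φ) (j + k) ?_ ?_ fun o i => ?_
  · rw [map_add, map_add, modOne_rename _ hΦ, modOne_rename _ hΨ]
  · rw [hj, hk, zpow_add₀ (by positivity)]
  · rw [hM, hN, mul_mul_mul_comm]
    congr 1
    rw [net_eq_sum, net_eq_sum, Finset.sum_mul_sum, sum_sumElim]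
    refine Finset.sum_congr rfl fun u _ => Finset.sum_congr rfl fun v _ => ?_
    obtain ⟨⟨o₁, o₂⟩, rfl⟩ := (Fin.appendEquiv m m').surjective o
    obtain ⟨⟨i₁, i₂⟩, rfl⟩ := (Fin.appendEquiv n n').surjective i
    simp only [ev_append, ev_rename, map_add, sgn_add, Fin.appendEquiv, Equiv.coe_fn_mk,
      kron_append, Fin.append_left, Fin.append_right, values, Sum.elim_inl, Sum.elim_inr]
    ring

/-- Summing over the `m` intermediate variables gives `2 ^ m` times the indicator that the output of
`g` equals the input of `f`. The factor cancels the one in `SOP.comp`, leaving the matrix product.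
-/
theorem Denotes.comp {n m k : ℕ} {f : SOP m k} {g : SOP n m}
    {M : Mat m k}
    {N : Mat n m} (hf : f.Denotes M) (hg : g.Denotes N) :
    (f.comp g).Denotes fun o i => ∑ x, M o x * N x i := by
  obtain ⟨Φ, p, hΦ, hp, hM⟩ := hf
  obtain ⟨Ψ, q, hΨ, hq, hN⟩ := hg
  let ig : g.V → f.V ⊕ g.V ⊕ Fin m := fun v => Sum.inr (Sum.inl v)
  let Θ : BPoly (ZMod 2) (f.V ⊕ g.V ⊕ Fin m) := rename ig Ψ + rename Sum.inl Φ +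
    ∑ i : Fin m, (rename ig (g.O i) * X _ (Sum.inr (Sum.inr i)) +
      rename Sum.inl (f.I i) * X _ (Sum.inr (Sum.inr i)))
  -- The division by `2 ^ m` lowers the exponent of `√2` by `2 * m`.
  refine ⟨Θ, p + q - 2 * m, ?_, ?_, fun o i => ?_⟩
  · change modOne (rename ig g.P + rename Sum.inl f.P + C _ (1 / 2) * ∑ i : Fin m,
      (hat (rename ig (g.O i)) + hat (rename Sum.inl (f.I i))) *
        X ℝ (Sum.inr (Sum.inr i))) = halfHat Θ
    simp only [Θ, map_add, map_sum, Finset.mul_sum, modOne_rename _ hΦ, modOne_rename _ hΨ]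
    congr 1
    refine Finset.sum_congr rfl fun i _ => ?_
    rw [halfHat_apply, halfHat_apply, ← map_add, hat_mul, hat_mul, hat_X]
    congr 1
    ring
  · change f.s * g.s / 2 ^ m = _
    have hsq : (√2 : ℝ) ^ (2 : ℤ) = 2 := by
      rw [zpow_ofNat]
      exact Real.sq_sqrt (by norm_num)
    rw [hp, hq, zpow_sub₀ (by positivity), zpow_add₀ (by positivity), zpow_mul, hsq, zpow_natCast]
  · classical
    have := Fintype.ofFinite f.V
    have := Fintype.ofFinite g.V
    have hs : (f.comp g).s = f.s * g.s / 2 ^ m := rfl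
    have hnet : (net ((f.comp g).values Θ) (o, i) : ℝ) = ∑ u : f.V → ZMod 2, ∑ v : g.V → ZMod 2,
        2 ^ m * (sgn (ev u Φ) * kron (fun j => ev u (f.O j)) o *
          (sgn (ev v Ψ) * kron (fun j => ev v (g.I j)) i) *
          kron (fun j => ev u (f.I j)) fun j => ev v (g.O j)) := by
      refine ((net_eq_sum (V := f.V ⊕ g.V ⊕ Fin m) _ o i).trans (sum_sumElim _)).trans ?_
      refine Finset.sum_congr rfl fun u _ => (sum_sumElim _).trans ?_
      refine Finset.sum_congr rfl fun v _ => ?_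
      have hy : ∀ y : Fin m → ZMod 2, (f.comp g).values Θ (Sum.elim u (Sum.elim v y)) =
          (ev v Ψ + ev u Φ + ∑ j, (ev v (g.O j) + ev u (f.I j)) * y j,
            fun j => ev u (f.O j), fun j => ev v (g.I j)) := by
        intro y
        refine Prod.ext ?_ (Prod.ext (funext fun j => ?_) (funext fun j => ?_))
        · change ev (Sum.elim u (Sum.elim v y)) Θ = _
          simp [Θ, ig, add_mul]
        · exact ev_rename _ _ _
        · exact ev_rename _ _ _
      simp only [hy, sgn_add]
      rw [← Finset.sum_mul, ← Finset.mul_sum, sum_sgn_linear, Fintype.card_fin]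
      have hk : kron (fun j => ev v (g.O j) + ev u (f.I j)) 0 =
          kron (fun j => ev u (f.I j)) fun j => ev v (g.O j) := by
        refine kron_congr ?_
        have h2 : ∀ x y : ZMod 2, x + y = 0 ↔ y = x := by decide
        simp [funext_iff, h2]
      rw [hk]
      ring
    rw [hs, hnet]
    simp only [hM, hN, net_eq_sum, values]
    simp only [Finset.mul_sum, Finset.sum_mul]
    rw [Finset.sum_comm]
    rw [Finset.sum_congr rfl fun _ _ => Finset.sum_comm]
    rw [Finset.sum_comm]
    refine Finset.sum_congr rfl fun u _ => Finset.sum_congr rfl fun v _ => ?_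
    have : ∀ x : Fin m → ZMod 2,
      f.s * (sgn (ev u Φ) * (kron (fun j => ev u (f.O j)) o * kron (fun j => ev u (f.I j)) x)) *
        (g.s * (sgn (ev v Ψ) * (kron (fun j => ev v (g.O j)) x * kron (fun j => ev v (g.I j)) i)))
      = kron (fun j => ev u (f.I j)) x * ((f.s * g.s) * (sgn (ev u Φ) *
        kron (fun j => ev u (f.O j)) o * (sgn (ev v Ψ) * kron (fun j => ev v (g.I j)) i) *
          kron x fun j => ev v (g.O j))) := by
      intro x
      rw [kron_comm x]
      ring
    simp only [this, sum_kron_mul]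
    field_simp

theorem hat_prod {V ι : Type} (S : Finset ι) (f : ι → BPoly (ZMod 2) V) :
    hat (∏ k ∈ S, f k) = ∏ k ∈ S, hat (f k) := by
  classical
  induction S using Finset.induction_on with
  | empty => simp [hat_one]
  | insert k S hk ih => rw [Finset.prod_insert hk, Finset.prod_insert hk, hat_mul, ih]

end SOP

namespace ZHTH

open BPoly SOP

theorem denotes_sem {n m : ℕ} (D : ZHTH n m) : D.toSOP.Denotes D.sem := by
  induction D with
  | Z n m =>
    refine .intro_zero (V := Unit) fun o i => ?_
    rw [sum_unique]
    simp only [ev_X]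
    refine Finset.sum_congr rfl fun b _ => ?_
    rw [kron_comm o, kron_comm i]
  | H n m =>
    refine .intro (V := Fin n ⊕ Fin m)
      ((∏ i, BPoly.X _ (Sum.inl i)) * ∏ j, BPoly.X _ (Sum.inr j)) 0 ?_ (zpow_zero _).symm
      fun o i => ?_
    · rw [halfHat_apply, hat_mul, hat_prod, hat_prod]
      simp only [hat_X]
    · rw [one_mul, sum_sumElim]
      simp only [map_mul, map_prod, ev_X, Sum.elim_inl, Sum.elim_inr,
        mul_comm (kron _ o), ← mul_assoc, sum_mul_kron]
      rfl
  | sqrtHalf =>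
    refine .intro (V := Empty) 0 (-1) (by rw [map_zero, map_zero]) ?_ fun o i => ?_
    · rw [zpow_neg_one, one_div]
    · rw [Fintype.sum_unique, map_zero, sgn_zero, kron_of_subsingleton, kron_of_subsingleton,
        mul_one, mul_one, mul_one]
      rfl
  | id n =>
    refine .intro_zero (V := Fin n) fun o i => ?_
    simp only [ev_X, kron_comm _ o]
    exact (sum_kron_mul o fun a => kron a i).symm
  | swap n m =>
    refine .intro_zero (V := Fin n ⊕ Fin m) fun o i => ?_
    obtain ⟨⟨o₁, o₂⟩, rfl⟩ := (Fin.appendEquiv m n).surjective o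
    obtain ⟨⟨i₁, i₂⟩, rfl⟩ := (Fin.appendEquiv n m).surjective i
    rw [sum_sumElim]
    simp only [ev_append, ev_X, Sum.elim_inl, Sum.elim_inr, Fin.appendEquiv, Equiv.coe_fn_mk,
      kron_append, sem, Fin.append_left, Fin.append_right]
    simp only [← mul_assoc, sum_mul_kron]
    rw [kron_comm o₁, kron_comm o₂]
  | cup n =>
    refine .intro_zero (V := Fin n) fun o i => ?_
    obtain ⟨⟨o₁, o₂⟩, rfl⟩ := (Fin.appendEquiv n n).surjective o
    refine Eq.trans (b := ∑ a, kron o₁ a * kron a o₂) ?_ (Finset.sum_congr rfl fun a _ => ?_)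
    · simp only [sum_kron_mul, sem, Fin.appendEquiv, Equiv.coe_fn_mk, Fin.append_left,
        Fin.append_right]
    · rw [kron_of_subsingleton _ i, mul_one, ev_append, Fin.appendEquiv, Equiv.coe_fn_mk,
        kron_append]
      simp only [ev_X, kron_comm o₁]
  | cap n =>
    refine .intro_zero (V := Fin n) fun o i => ?_
    obtain ⟨⟨i₁, i₂⟩, rfl⟩ := (Fin.appendEquiv n n).surjective i
    refine Eq.trans (b := ∑ a, kron i₁ a * kron a i₂) ?_ (Finset.sum_congr rfl fun a _ => ?_)
    · simp only [sum_kron_mul, sem, Fin.appendEquiv, Equiv.coe_fn_mk, Fin.append_left,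
        Fin.append_right]
    · rw [kron_of_subsingleton _ o, one_mul, ev_append, Fin.appendEquiv, Equiv.coe_fn_mk,
        kron_append]
      simp only [ev_X, kron_comm i₁]
  | comp f g hf hg => exact hf.comp hg
  | tensor f g hf hg => exact hf.tensor hg

end ZHTH

namespace ZHTH

/-! ### Soundness of the axioms for the matrix semantics -/

theorem sem_cast {n n' m m' : ℕ} (hn : n = n') (hm : m = m') (D : ZHTH n m)
    (o : Fin m' → ZMod 2) (i : Fin n' → ZMod 2) :
    (cast hn hm D).sem o i = D.sem (fun k => o (Fin.cast hm k)) fun k => i (Fin.cast hn k) := by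
  subst hn hm
  rfl

theorem sem_comp {n m k : ℕ} (f : ZHTH m k) (g : ZHTH n m) (o : Fin k → ZMod 2)
    (i : Fin n → ZMod 2) : (f ∘z g).sem o i = ∑ x, f.sem o x * g.sem x i := rfl

theorem sem_id {n : ℕ} (o i : Fin n → ZMod 2) : (id n).sem o i = kron o i := rfl

theorem sem_Z {n m : ℕ} (o : Fin m → ZMod 2) (i : Fin n → ZMod 2) :
    (Z n m).sem o i = ∑ b : ZMod 2, kron o (fun _ => b) * kron i fun _ => b := rfl

theorem sem_H {n m : ℕ} (o : Fin m → ZMod 2) (i : Fin n → ZMod 2) :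
    (H n m).sem o i = sgn ((∏ k, i k) * ∏ k, o k) := rfl

theorem sem_tensor_append {n m n' m' : ℕ} (f : ZHTH n m) (g : ZHTH n' m') (o : Fin m → ZMod 2)
    (o' : Fin m' → ZMod 2) (i : Fin n → ZMod 2) (i' : Fin n' → ZMod 2) :
    (f ⊗z g).sem (Fin.append o o') (Fin.append i i') = f.sem o i * g.sem o' i' := by
  simp only [sem, Fin.append_left, Fin.append_right]

theorem sem_swap_append {n m : ℕ} (o : Fin m → ZMod 2) (o' : Fin n → ZMod 2)
    (i : Fin n → ZMod 2) (i' : Fin m → ZMod 2) :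
    (swap n m).sem (Fin.append o o') (Fin.append i i') = kron o i' * kron o' i := by
  simp only [sem, Fin.append_left, Fin.append_right, kron_append]

theorem sem_cup_append {n : ℕ} (o o' : Fin n → ZMod 2) (i : Fin 0 → ZMod 2) :
    (cup n).sem (Fin.append o o') i = kron o o' := by
  simp only [sem, Fin.append_left, Fin.append_right]

theorem sem_cap_append {n : ℕ} (o : Fin 0 → ZMod 2) (i i' : Fin n → ZMod 2) :
    (cap n).sem o (Fin.append i i') = kron i i' := by
  simp only [sem, Fin.append_left, Fin.append_right]

theorem exists_append {a b : ℕ} (o : Fin (a + b) → ZMod 2) : ∃ u v, o = Fin.append u v :=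
  ⟨_, _, (Fin.append_castAdd_natAdd (f := o)).symm⟩

theorem append_apply {a b : ℕ} (u : Fin a → ZMod 2) (v : Fin b → ZMod 2) (k : Fin (a + b)) :
    Fin.append u v k = if h : k.1 < a then u ⟨k.1, h⟩ else v ⟨k.1 - a, by lia⟩ := by
  refine Fin.addCases (fun k => ?_) (fun k => ?_) k <;> simp

theorem append_assoc_left {a b c : ℕ} (u : Fin a → ZMod 2) (v : Fin b → ZMod 2)
    (w : Fin c → ZMod 2) (h : a + (b + c) = a + b + c) :
    (fun k => Fin.append (Fin.append u v) w (Fin.cast h k)) = Fin.append u (Fin.append v w) := by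
  rw [Fin.append_assoc]
  rfl

theorem append_assoc_right {a b c : ℕ} (u : Fin a → ZMod 2) (v : Fin b → ZMod 2)
    (w : Fin c → ZMod 2) (h : a + b + c = a + (b + c)) :
    (fun k => Fin.append u (Fin.append v w) (Fin.cast h k)) = Fin.append (Fin.append u v) w := by
  rw [Fin.append_assoc]
  rfl

theorem elim0_append_cast {a : ℕ} (u : Fin a → ZMod 2) (v : Fin 0 → ZMod 2) (h : 0 + a = a) :
    (fun k => u (Fin.cast h k)) = Fin.append v u := by
  funext k
  simp [append_apply]
  rfl

theorem append_elim0_cast {a : ℕ} (u : Fin a → ZMod 2) (v : Fin 0 → ZMod 2) (h : a + 0 = a) :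
    (fun k => u (Fin.cast h k)) = Fin.append u v := by
  funext k
  have := k.2
  simp [append_apply]

theorem const_append {a b : ℕ} (x : ZMod 2) :
    (fun _ : Fin (a + b) => x) = Fin.append (fun _ : Fin a => x) fun _ : Fin b => x := by
  funext k
  refine Fin.addCases (fun k => ?_) (fun k => ?_) k <;> simp

theorem kron_const {ι : Type} [Fintype ι] [DecidableEq ι] [Nonempty ι] (x y : ZMod 2) :
    kron (fun _ : ι => x) (fun _ => y) = kron x y :=
  kron_congr ⟨fun h => congrFun h (Classical.arbitrary ι), fun h => funext fun _ => h⟩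

/-- All entries are real, so the dagger is transposition. -/
theorem sem_dagger {n m : ℕ} (D : ZHTH n m) (o : Fin n → ZMod 2) (i : Fin m → ZMod 2) :
    D.dagger.sem o i = D.sem i o := by
  induction D with
  | Z n m => simp only [dagger, sem_Z, mul_comm]
  | H n m => simp only [dagger, sem_H, mul_comm]
  | sqrtHalf => rfl
  | id n => exact kron_comm _ _
  | swap n m =>
    obtain ⟨o, o', rfl⟩ := exists_append o
    obtain ⟨i, i', rfl⟩ := exists_append i
    simp only [dagger, sem_swap_append]
    rw [kron_comm o, kron_comm o', mul_comm]
  | cup n => rfl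
  | cap n => rfl
  | comp f g hf hg =>
    simp only [dagger, sem_comp, hf, hg, mul_comm]
  | tensor f g hf hg => simp only [dagger, sem, hf, hg]

theorem sem_swap_comp {n m k : ℕ} (D : ZHTH k (n + m)) (o : Fin m → ZMod 2)
    (o' : Fin n → ZMod 2) (i : Fin k → ZMod 2) :
    (swap n m ∘z D).sem (Fin.append o o') i = D.sem (Fin.append o' o) i := by
  simp only [sem_comp, sum_append, sem_swap_append]
  simp only [mul_assoc, sum_kron_mul]

theorem sem_comp_swap {n m k : ℕ} (D : ZHTH (m + n) k) (o : Fin k → ZMod 2)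
    (i : Fin n → ZMod 2) (i' : Fin m → ZMod 2) :
    (D ∘z swap n m).sem o (Fin.append i i') = D.sem o (Fin.append i' i) := by
  simp only [sem_comp, sum_append, sem_swap_append]
  simp only [← mul_assoc, sum_mul_kron]

theorem sem_swap_natural {n m n' m' : ℕ} (f : ZHTH n m) (g : ZHTH n' m') :
    (swap m m' ∘z (f ⊗z g)).sem = ((g ⊗z f) ∘z swap n n').sem := by
  funext o i
  obtain ⟨o, o', rfl⟩ := exists_append o
  obtain ⟨i, i', rfl⟩ := exists_append i
  rw [sem_swap_comp, sem_comp_swap, sem_tensor_append, sem_tensor_append, mul_comm]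

theorem sem_interchange {n m k n' m' k' : ℕ} (f : ZHTH m k) (g : ZHTH n m) (f' : ZHTH m' k')
    (g' : ZHTH n' m') :
    ((f ⊗z f') ∘z (g ⊗z g')).sem = ((f ∘z g) ⊗z (f' ∘z g')).sem := by
  funext o i
  obtain ⟨o, o', rfl⟩ := exists_append o
  obtain ⟨i, i', rfl⟩ := exists_append i
  simp only [sem_tensor_append, sem_comp, sum_append, Finset.sum_mul_sum, mul_mul_mul_comm]

theorem sem_id_comp {n m : ℕ} (D : ZHTH n m) : (id m ∘z D).sem = D.sem := by
  funext o i
  simp only [sem_comp, sem_id, sum_kron_mul]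

theorem sem_comp_id {n m : ℕ} (D : ZHTH n m) : (D ∘z id n).sem = D.sem := by
  funext o i
  simp only [sem_comp, sem_id, sum_mul_kron]

theorem sem_comp_assoc {n m k l : ℕ} (f : ZHTH k l) (g : ZHTH m k) (h : ZHTH n m) :
    ((f ∘z g) ∘z h).sem = (f ∘z g ∘z h).sem := by
  funext o i
  simp only [sem_comp, Finset.sum_mul, Finset.mul_sum, mul_assoc]
  exact Finset.sum_comm

theorem sem_tensor_id (n m : ℕ) : (id n ⊗z id m).sem = (id (n + m)).sem := by
  funext o i
  obtain ⟨o, o', rfl⟩ := exists_append o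
  obtain ⟨i, i', rfl⟩ := exists_append i
  simp only [sem_tensor_append, sem_id, kron_append]

theorem sem_tensor_assoc {n m n' m' n'' m'' : ℕ} (f : ZHTH n m) (g : ZHTH n' m')
    (h : ZHTH n'' m'') : ((f ⊗z g) ⊗z h).sem =
      (cast (Nat.add_assoc n n' n'').symm (Nat.add_assoc m m' m'').symm (f ⊗z g ⊗z h)).sem := by
  funext o i
  obtain ⟨o, o'', rfl⟩ := exists_append o
  obtain ⟨o, o', rfl⟩ := exists_append o
  obtain ⟨i, i'', rfl⟩ := exists_append i
  obtain ⟨i, i', rfl⟩ := exists_append i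
  rw [sem_cast, append_assoc_left, append_assoc_left]
  simp only [sem_tensor_append, mul_assoc]

theorem sem_unit_tensor {n m : ℕ} (D : ZHTH n m) :
    (cast (Nat.zero_add n) (Nat.zero_add m) (id 0 ⊗z D)).sem = D.sem := by
  funext o i
  rw [sem_cast, elim0_append_cast o Fin.elim0, elim0_append_cast i Fin.elim0, sem_tensor_append,
    sem_id, kron_self, one_mul]

theorem sem_tensor_unit {n m : ℕ} (D : ZHTH n m) : (D ⊗z id 0).sem = D.sem := by
  funext o i
  refine Eq.trans ?_ (mul_one _)
  exact congrArg (D.sem o i * ·) (kron_of_subsingleton _ _)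

theorem sem_swap_swap (n m : ℕ) : (swap m n ∘z swap n m).sem = (id (n + m)).sem := by
  funext o i
  obtain ⟨o, o', rfl⟩ := exists_append o
  obtain ⟨i, i', rfl⟩ := exists_append i
  rw [sem_swap_comp, sem_swap_append, sem_id, kron_append, mul_comm]

theorem sem_hexagon (n m k : ℕ) : (swap n (m + k)).sem =
    (cast (Nat.add_assoc n m k) (Nat.add_assoc m k n).symm
      ((id m ⊗z swap n k) ∘z cast rfl (Nat.add_assoc m n k) (swap n m ⊗z id k))).sem := by
  funext o i
  obtain ⟨o, o'', rfl⟩ := exists_append o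
  obtain ⟨o, o', rfl⟩ := exists_append o
  obtain ⟨i, i'', rfl⟩ := exists_append i
  obtain ⟨i'', i', rfl⟩ := exists_append i''
  rw [sem_cast, append_assoc_left, append_assoc_right, sem_swap_append, kron_append]
  simp only [sem_comp, sum_append, sem_tensor_append, sem_swap_append, sem_id, sem_cast,
    append_assoc_right, Fin.cast_refl, id_eq]
  simp only [mul_assoc, ← Finset.mul_sum, sum_kron_mul]
  ring

theorem sem_snake (n : ℕ) :
    (cast (Nat.add_zero n) (Nat.zero_add n)
      ((cap n ⊗z id n) ∘z cast rfl (Nat.add_assoc n n n).symm (id n ⊗z cup n))).sem =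
    (id n).sem := by
  funext o i
  rw [sem_cast, elim0_append_cast o Fin.elim0, append_elim0_cast i Fin.elim0]
  simp only [sem_comp, sum_append, sem_tensor_append, sem_cap_append, sem_id, sem_cast,
    append_assoc_left, Fin.cast_refl, id_eq, sem_cup_append]
  simp only [mul_assoc, ← Finset.mul_sum, sum_kron_mul]
  exact (Finset.sum_congr rfl fun x _ => by rw [mul_comm, kron_comm x o]).trans
    (sum_kron_mul o fun x => kron x i)

theorem sem_swap_cup (n : ℕ) : (swap n n ∘z cup n).sem = (cup n).sem := by
  funext o i
  obtain ⟨o, o', rfl⟩ := exists_append o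
  rw [sem_swap_comp, sem_cup_append, sem_cup_append, kron_comm]

theorem append_four_cast {a b c d : ℕ} (u : Fin a → ZMod 2) (v : Fin b → ZMod 2)
    (w : Fin c → ZMod 2) (x : Fin d → ZMod 2) (h : a + b + (c + d) = a + (b + c + d)) :
    (fun k => Fin.append u (Fin.append (Fin.append v w) x) (Fin.cast h k)) =
      Fin.append (Fin.append u v) (Fin.append w x) := by
  funext k
  have := k.2
  simp only [append_apply, Fin.val_cast]
  split_ifs <;> first | rfl | (exfalso; lia) | (congr 2; lia)

theorem append_four_cast' {a b c d : ℕ} (u : Fin a → ZMod 2) (v : Fin b → ZMod 2)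
    (w : Fin c → ZMod 2) (x : Fin d → ZMod 2) (h : a + (b + c + d) = a + b + (c + d)) :
    (fun k => Fin.append (Fin.append u v) (Fin.append w x) (Fin.cast h k)) =
      Fin.append u (Fin.append (Fin.append v w) x) := by
  funext k
  have := k.2
  simp only [append_apply, Fin.val_cast]
  split_ifs <;> first | rfl | (exfalso; lia) | (congr 2; lia)

theorem sem_cup_add (n m : ℕ) : (cup (n + m)).sem =
    (cast rfl (by ring)
      ((id n ⊗z swap n m ⊗z id m) ∘z cast rfl (by ring) (cup n ⊗z cup m)) :
        ZHTH 0 (n + m + (n + m))).sem := by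
  funext o i
  obtain ⟨o, o', rfl⟩ := exists_append o
  obtain ⟨o₁, o₂, rfl⟩ := exists_append o
  obtain ⟨o₃, o₄, rfl⟩ := exists_append o'
  rw [sem_cast, append_four_cast', sem_cup_append, kron_append]
  simp only [sem_comp, sum_append, sem_tensor_append, sem_swap_append, sem_id, sem_cast,
    append_four_cast]
  -- The empty input is rewritten as an append so that `sem_tensor_append` applies.
  generalize (fun k => i _ : Fin (0 + 0) → ZMod 2) = j
  rw [show j = Fin.append Fin.elim0 Fin.elim0 from funext fun k => k.elim0]
  simp only [sem_tensor_append, sem_cup_append, mul_assoc, ← Finset.mul_sum, sum_kron_mul]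

end ZHTH

/-! ### Soundness of the spider rules. -/

namespace ZHTH

theorem prod_fin_one (f : Fin 1 → ZMod 2) : ∏ k, f k = f 0 := Fin.prod_univ_one f

theorem sgn_mul_mul_sgn (x y z : ZMod 2) : sgn (x * y) * sgn (x * z) = sgn (x * (y + z)) := by
  rw [mul_add, sgn_add]

theorem sum_sgn_mul (x : ZMod 2) : ∑ y, sgn (y * x) = 2 * kron x 0 := by
  have h2 : x = 0 ∨ x = 1 := by revert x; decide
  rw [SOP.sum_zmod_two]
  rcases h2 with rfl | rfl
  · simp [sgn_zero, kron]; norm_num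
  · simp [sgn_zero, sgn_one, kron]

theorem sem_half (o i : Fin 0 → ZMod 2) : half.sem o i = 1 / 2 := by
  change 1 / √2 * (1 / √2) = 1 / 2
  rw [div_mul_div_comm, one_mul, Real.mul_self_sqrt zero_le_two]

theorem sem_tensor_scalar {n m : ℕ} (f : ZHTH n m) (c : ZHTH 0 0) (o : Fin m → ZMod 2)
    (i : Fin n → ZMod 2) : (f ⊗z c).sem o i = f.sem o i * c.sem Fin.elim0 Fin.elim0 := by
  change f.sem o i * c.sem _ _ = _
  congr 2 <;> exact Subsingleton.elim _ _

theorem sem_hadamards {n : ℕ} (o i : Fin n → ZMod 2) :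
    (hadamards n).sem o i = sgn (∑ k, i k * o k) := by
  induction n with
  | zero =>
    rw [Finset.univ_eq_empty, Finset.sum_empty, sgn_zero]
    exact kron_of_subsingleton _ _
  | succ n ih =>
    rw [Fin.sum_univ_castSucc, sgn_add, ← ih (fun k => o k.castSucc) fun k => i k.castSucc]
    change _ * (H 1 1).sem _ _ = _
    rw [sem_H, prod_fin_one, prod_fin_one]
    rfl

/-- The Hadamard boxes turn the bit `b` of the Z-spider into the sign `(-1) ^ (b * parity)` of all
legs. Summing over `b` gives twice the indicator of even parity, and `half` removes the factor. -/
theorem sem_X {n m : ℕ} (o : Fin m → ZMod 2) (i : Fin n → ZMod 2) :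
    (X n m).sem o i = kron (∑ k, o k + ∑ k, i k) 0 := by
  refine (sem_tensor_scalar _ _ _ _).trans ?_
  have h : ∀ b : ZMod 2, ∑ x : Fin n → ZMod 2, kron x (fun _ => b) * (hadamards n).sem x i =
      sgn (b * ∑ k, i k) := by
    intro b
    simp only [sum_kron_mul', sem_hadamards]
    rw [← Finset.sum_mul, mul_comm]
  have h' : ∀ b : ZMod 2, ∑ x : Fin m → ZMod 2, (hadamards m).sem o x * kron x (fun _ => b) =
      sgn (b * ∑ k, o k) := by
    intro b
    simp only [sum_mul_kron, sem_hadamards, Finset.mul_sum]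
  have h'' : (hadamards m ∘z Z n m ∘z hadamards n).sem o i =
      ∑ b : ZMod 2, sgn (b * (∑ k, o k + ∑ k, i k)) := by
    simp only [← sgn_mul_mul_sgn, ← h, ← h', sem_comp, sem_Z, Finset.sum_mul_sum]
    simp only [Finset.sum_mul, Finset.mul_sum]
    rw [Finset.sum_comm]
    rw [Finset.sum_congr rfl fun x _ => Finset.sum_comm]
    rw [Finset.sum_comm]
    refine Finset.sum_congr rfl fun b _ => ?_
    rw [Finset.sum_comm]
    refine Finset.sum_congr rfl fun x _ => Finset.sum_congr rfl fun y _ => ?_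
    ring
  rw [h'', sum_sgn_mul, sem_half]
  ring

/-- The extra leg contributes `(-1) ^ b`, which selects odd parity. -/
theorem sem_Xneg (o : Fin 1 → ZMod 2) (i : Fin 0 → ZMod 2) :
    (Xneg 0 1).sem o i = kron (o 0) 1 := by
  refine (sem_tensor_scalar _ _ _ _).trans ?_
  have h : ∀ x : Fin 1 → ZMod 2, (hadamards 0 ⊗z H 0 1).sem x i = sgn (x 0) := by
    intro x
    change kron _ _ * (H 0 1).sem _ _ = _
    rw [kron_of_subsingleton, one_mul, sem_H, prod_fin_one, Finset.univ_eq_empty,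
      Finset.prod_empty, one_mul]
    rfl
  have h2 : ∀ x : ZMod 2, x = 0 ∨ x = 1 := by decide
  have h3 : kron (0 : ZMod 2) 1 = 0 := if_neg zero_ne_one
  have h4 : kron (1 : ZMod 2) 0 = 0 := if_neg one_ne_zero
  have h' : (hadamards 1 ∘z Z 1 1 ∘z (hadamards 0 ⊗z H 0 1)).sem o i = 2 * kron (o 0) 1 := by
    simp only [sem_comp, h, sem_Z, sem_hadamards, sum_unique, kron_const, Fin.sum_univ_one]
    simp only [SOP.sum_zmod_two, h3, h4, kron_self, sgn_zero, sgn_one]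
    rcases h2 (o 0) with ho | ho <;> rw [ho] <;> simp [sgn_zero, sgn_one, h3, kron_self]
    norm_num
  rw [h', sem_half]
  ring

theorem sem_ZS1 (n m : ℕ) : (Z 1 m ∘z Z n 1).sem = (Z n m).sem := by
  funext o i
  simp only [sem_comp, sem_Z, sum_unique, kron_const]
  simp only [sum_mul_kron', sum_kron_mul]

theorem sem_ZS2 : (Z 1 1).sem = (id 1).sem := by
  funext o i
  have h : ∀ u : Fin 1 → ZMod 2, u = fun _ => u 0 := fun u =>
    funext fun k => congrArg u (Subsingleton.elim _ _)
  rw [h o, h i, sem_Z, sem_id]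
  simp only [kron_const, kron_comm (i 0), sum_kron_mul]

theorem sem_HS1 (n m : ℕ) : (H 1 m ∘z H 1 1 ∘z H n 1).sem = (H n m ⊗z Z 0 0).sem := by
  funext o i
  rw [sem_tensor_scalar]
  simp only [sem_comp, sem_H, sem_Z, sum_unique, prod_fin_one, SOP.sum_zmod_two,
    kron_of_subsingleton]
  generalize ∏ k, o k = x
  generalize ∏ k, i k = y
  have h2 : ∀ x : ZMod 2, x = 0 ∨ x = 1 := by decide
  rcases h2 x with rfl | rfl <;> rcases h2 y with rfl | rfl <;> simp [sgn_zero, sgn_one]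

theorem sem_HS2 : (H 1 1 ∘z H 1 1).sem = (id 1 ⊗z Z 0 0).sem := by
  funext o i
  have h : ∀ u : Fin 1 → ZMod 2, u = fun _ => u 0 := fun u =>
    funext fun k => congrArg u (Subsingleton.elim _ _)
  rw [sem_tensor_scalar, h o, h i]
  simp only [sem_comp, sem_H, sem_Z, sem_id, kron_const, sum_unique, prod_fin_one,
    SOP.sum_zmod_two, kron_of_subsingleton]
  generalize o 0 = x
  generalize i 0 = y
  have h2 : ∀ x : ZMod 2, x = 0 ∨ x = 1 := by decide
  rcases h2 x with rfl | rfl <;> rcases h2 y with rfl | rfl <;> simp [sgn_zero, sgn_one, kron]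

theorem sem_M : (Z 2 1 ∘z (H 0 1 ⊗z H 0 1)).sem = (Z 0 1).sem := by
  funext o i
  have ht : ∀ x : Fin 2 → ZMod 2, (H 0 1 ⊗z H 0 1).sem x i = sgn (x 0) * sgn (x 1) := by
    intro x
    change (H 0 1).sem _ _ * (H 0 1).sem _ _ = _
    simp only [sem_H, prod_fin_one, Finset.univ_eq_empty, Finset.prod_empty, one_mul]
    rfl
  have hs : ∀ b : ZMod 2, sgn b * sgn b = 1 := by
    intro b
    rw [← sgn_add, ← sgn_zero]
    congr 1
    revert b
    decide
  have hk : kron i = fun _ => 1 := funext fun _ => kron_of_subsingleton (α := Fin 0 → ZMod 2) _ _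
  rw [sem_comp]
  simp only [sem_Z, ht, Finset.sum_mul]
  rw [Finset.sum_comm]
  refine Finset.sum_congr rfl fun b _ => ?_
  simp only [mul_assoc, ← Finset.mul_sum, sum_kron_mul', hs, hk]

theorem sem_CPH : (H 1 2 ∘z H 0 1).sem = ((Xneg 0 1 ⊗z Xneg 0 1) ⊗z Z 0 0).sem := by
  funext o i
  have ht : (Xneg 0 1 ⊗z Xneg 0 1).sem o i = kron (o 0) 1 * kron (o 1) 1 := by
    change (Xneg 0 1).sem _ _ * (Xneg 0 1).sem _ _ = _
    rw [sem_Xneg, sem_Xneg]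
    rfl
  refine Eq.trans ?_ (sem_tensor_scalar (Xneg 0 1 ⊗z Xneg 0 1) (Z 0 0) o i).symm
  rw [ht]
  simp only [sem_comp, sem_H, sem_Z, sum_unique, prod_fin_one, SOP.sum_zmod_two,
    kron_of_subsingleton, Finset.univ_eq_empty, Finset.prod_empty, Fin.prod_univ_two]
  generalize o 0 = x
  generalize o 1 = y
  have h2 : ∀ x : ZMod 2, x = 0 ∨ x = 1 := by decide
  rcases h2 x with rfl | rfl <;> rcases h2 y with rfl | rfl <;> simp [sgn_zero, sgn_one, kron]

theorem sem_IP : (H 2 1 ∘z Z 1 2).sem = (H 1 1).sem := by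
  funext o i
  have h : ∀ u : Fin 1 → ZMod 2, u = fun _ => u 0 := fun u =>
    funext fun k => congrArg u (Subsingleton.elim _ _)
  rw [h i]
  simp only [sem_comp, sem_H, sem_Z, prod_fin_one, kron_const, sum_mul_kron', sum_mul_kron,
    Fin.prod_univ_two]
  -- Both inputs of the H-spider carry the same bit, and squaring is the identity on `ZMod 2`.
  rw [← pow_two, ZMod.pow_card]

theorem sem_IV : (half ⊗z Z 0 0).sem = (id 0).sem := by
  funext o i
  rw [sem_tensor_scalar, sem_half, sem_Z, sem_id]
  simp only [kron_of_subsingleton, SOP.sum_zmod_two]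
  norm_num

theorem sem_Z0 : (sqrtHalf ⊗z (Z 1 0 ∘z H 0 1)).sem = (Z 1 0 ∘z H 0 1).sem := by
  funext o i
  -- This scalar is `1 + (-1)`, so the factor `1 / √2` has no effect.
  have h : ∀ o i, (Z 1 0 ∘z H 0 1).sem o i = 0 := by
    intro o i
    simp only [sem_comp, sem_H, sem_Z, sum_unique, prod_fin_one, kron_const,
      kron_of_subsingleton o, one_mul, SOP.sum_zmod_two, Finset.univ_eq_empty, Finset.prod_empty]
    simp [kron, sgn_zero, sgn_one]
  rw [h]
  refine Eq.trans (congrArg (1 / √2 * ·) (h _ _)) (mul_zero _)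

theorem sem_comp_transposition {a b m : ℕ} (D : ZHTH (a + ((1 + 1) + b)) m) (o : Fin m → ZMod 2)
    (i₁ : Fin a → ZMod 2) (i₂ i₃ : Fin 1 → ZMod 2) (i₄ : Fin b → ZMod 2) :
    (D ∘z (id a ⊗z swap 1 1 ⊗z id b)).sem o
        (Fin.append i₁ (Fin.append (Fin.append i₂ i₃) i₄)) =
      D.sem o (Fin.append i₁ (Fin.append (Fin.append i₃ i₂) i₄)) := by
  simp only [sem_comp, sum_append, sem_tensor_append, sem_id, sem_swap_append]
  simp only [← mul_assoc, sum_mul_kron]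

theorem sem_Z_perm (a b m : ℕ) :
    (Z (a + ((1 + 1) + b)) m ∘z (id a ⊗z swap 1 1 ⊗z id b)).sem =
      (Z (a + ((1 + 1) + b)) m).sem := by
  funext o i
  obtain ⟨i₁, i, rfl⟩ := exists_append i
  obtain ⟨i, i₄, rfl⟩ := exists_append i
  obtain ⟨i₂, i₃, rfl⟩ := exists_append i
  rw [sem_comp_transposition]
  simp only [sem_Z, const_append, kron_append, mul_comm (kron i₂ _)]

theorem sem_H_perm (a b m : ℕ) :
    (H (a + ((1 + 1) + b)) m ∘z (id a ⊗z swap 1 1 ⊗z id b)).sem =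
      (H (a + ((1 + 1) + b)) m).sem := by
  funext o i
  obtain ⟨i₁, i, rfl⟩ := exists_append i
  obtain ⟨i, i₄, rfl⟩ := exists_append i
  obtain ⟨i₂, i₃, rfl⟩ := exists_append i
  rw [sem_comp_transposition]
  simp only [sem_H, Fin.prod_univ_add, Fin.append_left, Fin.append_right]
  congr 1
  ring

/-- Bending with a cup only moves a bit from the inputs to the outputs. Spiders treat all legs
alike, so both bending rules follow. -/
theorem sem_bend {n m : ℕ} (D : ZHTH (n + 1) m) (o : Fin m → ZMod 2) (o' : Fin 1 → ZMod 2)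
    (i : Fin n → ZMod 2) :
    ((D ⊗z id 1) ∘z cast (Nat.add_zero n) (Nat.add_assoc n 1 1).symm (id n ⊗z cup 1)).sem
      (Fin.append o o') i = D.sem o (Fin.append i o') := by
  simp only [sem_comp, sum_append, sem_tensor_append, sem_id, sem_cast, append_assoc_left,
    append_elim0_cast i Fin.elim0, sem_cup_append]
  simp only [mul_assoc, sum_kron_mul, ← Finset.mul_sum]
  simp only [mul_comm (kron _ i), ← mul_assoc]
  simp only [mul_right_comm _ (kron _ o'), sum_mul_kron]

theorem sem_Z_bend (n m : ℕ) : (Z n (m + 1)).sem =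
    ((Z (n + 1) m ⊗z id 1) ∘z
      cast (Nat.add_zero n) (Nat.add_assoc n 1 1).symm (id n ⊗z cup 1)).sem := by
  funext o i
  obtain ⟨o, o', rfl⟩ := exists_append o
  rw [sem_bend]
  simp only [sem_Z, const_append, kron_append]
  exact Finset.sum_congr rfl fun b _ => by ring

theorem sem_H_bend (n m : ℕ) : (H n (m + 1)).sem =
    ((H (n + 1) m ⊗z id 1) ∘z
      cast (Nat.add_zero n) (Nat.add_assoc n 1 1).symm (id n ⊗z cup 1)).sem := by
  funext o i
  obtain ⟨o, o', rfl⟩ := exists_append o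
  rw [sem_bend]
  simp only [sem_H, Fin.prod_univ_add, Fin.append_left, Fin.append_right]
  congr 1
  ring

/-! ### Wirings -/

/-- The `l`-th wire of the `j`-th group of `b`. -/
def wire {k : ℕ} (b : ℕ) (j : Fin k) (l : Fin b) : Fin (b * k) :=
  ⟨b * j + l, calc
    b * j.1 + l.1 < b * j + b := by lia
    _ = b * (j + 1) := rfl
    _ ≤ b * k := Nat.mul_le_mul_left b j.2⟩

theorem sem_rowIn {b k : ℕ} (D : ZHTH 1 b) (o : Fin (b * k) → ZMod 2) (i : Fin k → ZMod 2) :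
    (rowIn D k).sem o i = ∏ j, D.sem (fun l => o (wire b j l)) fun _ => i j := by
  induction k with
  | zero =>
    rw [Finset.univ_eq_empty, Finset.prod_empty]
    exact kron_of_subsingleton (α := Fin 0 → ZMod 2) _ _
  | succ k ih =>
    rw [Fin.prod_univ_castSucc]
    change (rowIn D k).sem _ _ * D.sem _ _ = _
    rw [ih]
    congr 2
    funext l
    exact congrArg i (Fin.ext (by simp))

theorem sem_rowOut {a k : ℕ} (D : ZHTH a 1) (o : Fin k → ZMod 2) (i : Fin (a * k) → ZMod 2) :
    (rowOut D k).sem o i = ∏ j, D.sem (fun _ => o j) fun l => i (wire a j l) := by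
  induction k with
  | zero =>
    rw [Finset.univ_eq_empty, Finset.prod_empty]
    exact kron_of_subsingleton (α := Fin 0 → ZMod 2) _ _
  | succ k ih =>
    rw [Fin.prod_univ_castSucc]
    change (rowOut D k).sem _ _ * D.sem _ _ = _
    rw [ih]
    congr 2
    funext l
    exact congrArg o (Fin.ext (by simp))

/-- The diagram `D` connects its `k`-th input with its `e k`-th output. -/
def IsWiring {n m : ℕ} (D : ZHTH n m) (e : ℕ → ℕ) : Prop :=
  ∃ he : ∀ k : Fin n, e k < m, ∀ o i, D.sem o i = kron (fun k : Fin n => o ⟨e k, he k⟩) i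

theorem isWiring_id (n : ℕ) : (id n).IsWiring fun k => k := ⟨fun k => k.2, fun _ _ => rfl⟩

theorem IsWiring.comp {n m k : ℕ} {f : ZHTH m k} {g : ZHTH n m} {e e' : ℕ → ℕ}
    (hf : f.IsWiring e) (hg : g.IsWiring e') : (f ∘z g).IsWiring fun k => e (e' k) := by
  obtain ⟨he, hf⟩ := hf
  obtain ⟨he', hg⟩ := hg
  refine ⟨fun k => he ⟨e' k, he' k⟩, fun o i => ?_⟩
  simp only [sem_comp, hf, hg, sum_kron_mul]

/-- Wire maps act on natural numbers rather than on `Fin`, so transport does not alter them. -/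
theorem IsWiring.cast {n n' m m' : ℕ} {D : ZHTH n m} {e : ℕ → ℕ} (h : D.IsWiring e)
    (hn : n = n') (hm : m = m') : (cast hn hm D).IsWiring e := by
  subst hn hm
  exact h

theorem IsWiring.tensor {n m n' m' : ℕ} {f : ZHTH n m} {g : ZHTH n' m'} {e e' : ℕ → ℕ}
    (hf : f.IsWiring e) (hg : g.IsWiring e') :
    (f ⊗z g).IsWiring fun k => if k < n then e k else m + e' (k - n) := by
  obtain ⟨he, hf⟩ := hf
  obtain ⟨he', hg⟩ := hg
  refine ⟨fun k => ?_, fun o i => ?_⟩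
  · have := k.2
    beta_reduce
    split_ifs with hk
    · exact (he ⟨k, hk⟩).trans_le (by lia)
    · exact Nat.add_lt_add_left (he' ⟨k - n, by lia⟩) m
  · obtain ⟨i, i', rfl⟩ := exists_append i
    obtain ⟨o, o', rfl⟩ := exists_append o
    rw [sem_tensor_append, hf, hg, ← kron_append]
    congr 1
    funext k
    simp only [append_apply]
    split_ifs with hk hk' <;>
      first | rfl | (exfalso; lia) | (congr 2; lia) | exact absurd (he ⟨k, hk⟩) hk'

theorem isWiring_swap (n m : ℕ) :
    (swap n m).IsWiring fun k => if k < n then m + k else k - n := by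
  refine ⟨fun k => ?_, fun o i => ?_⟩
  · have := k.2
    beta_reduce
    split_ifs <;> lia
  · obtain ⟨i, i', rfl⟩ := exists_append i
    obtain ⟨o, o', rfl⟩ := exists_append o
    rw [sem_swap_append, mul_comm, ← kron_append]
    congr 1
    funext k
    have := k.2
    simp only [append_apply]
    split_ifs with hk <;> first | rfl | (exfalso; lia) | (congr 2; lia)

theorem exists_isWiring_interleave (m n : ℕ) : ∃ e, (interleave m n).IsWiring e ∧
    (∀ j < n, ∀ i < m, e (m * j + i) = (m + 1) * j + i) ∧
    ∀ j < n, e (m * n + j) = (m + 1) * j + m := by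
  induction n with
  | zero => exact ⟨fun k => k, isWiring_id 0, by simp, by simp⟩
  | succ n ih =>
    obtain ⟨e, he, h₁, h₂⟩ := ih
    -- The map `f` moves the last group of `m` wires past the first `n` single wires. The last group
    -- then stands next to its own single wire, and the recursion handles everything to the left.
    obtain ⟨f, hf, f₁, f₂, f₃, f₄⟩ : ∃ f, (ZHTH.cast (by ring) (by ring)
        (id (m * n) ⊗z swap m n ⊗z id 1) :
          ZHTH (m * (n + 1) + (n + 1)) (m * n + n + (m + 1))).IsWiring f ∧
        (∀ k < m * n, f k = k) ∧ (∀ i < m, f (m * n + i) = m * n + n + i) ∧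
        (∀ j < n, f (m * n + m + j) = m * n + j) ∧ f (m * n + m + n) = m * n + m + n := by
      refine ⟨_, ((isWiring_id _).tensor ((isWiring_swap m n).tensor (isWiring_id 1))).cast _ _,
        fun k hk => ?_, fun k hk => ?_, fun k hk => ?_, ?_⟩ <;> split_ifs <;> lia
    refine ⟨_, (he.tensor (isWiring_id (m + 1))).comp hf, fun j hj i hi => ?_, fun j hj => ?_⟩
    · rcases Nat.lt_succ_iff_lt_or_eq.mp hj with hj | rfl
      · have hlt : m * j + i < m * n := calc
          m * j + i < m * (j + 1) := by rw [mul_add]; lia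
          _ ≤ m * n := Nat.mul_le_mul_left m hj
        rw [f₁ _ hlt, if_pos (by lia), h₁ j hj i hi]
      · rw [f₂ i hi, if_neg (by lia)]
        lia
    · rw [mul_add m n 1, mul_one]
      rcases Nat.lt_succ_iff_lt_or_eq.mp hj with hj | rfl
      · rw [f₃ j hj, if_pos (by lia), h₂ j hj]
      · rw [f₄, if_neg (by lia)]
        lia

/-- Transposition of an index pair, by induction on the number of groups: `interleave` distributes
the wires of the last group to the ends of the others. -/
theorem exists_isWiring_shuffle (n m : ℕ) : ∃ e, (shuffle n m).IsWiring e ∧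
    ∀ i < m, ∀ j < n, e (n * i + j) = m * j + i := by
  induction m with
  | zero => exact ⟨_, (isWiring_id 0).cast _ _, by simp⟩
  | succ m ih =>
    obtain ⟨e, he, h⟩ := ih
    obtain ⟨e', he', h₁, h₂⟩ := exists_isWiring_interleave m n
    refine ⟨_, he'.comp (he.tensor (isWiring_id n)), fun i hi j hj => ?_⟩
    rcases Nat.lt_succ_iff_lt_or_eq.mp hi with hi | rfl
    · have hlt : n * i + j < n * m := calc
        n * i + j < n * (i + 1) := by rw [mul_add]; lia
        _ ≤ n * m := Nat.mul_le_mul_left n hi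
      rw [if_pos hlt, h i hi j hj, h₁ j hj i hi]
    · rw [if_neg (by lia), Nat.add_sub_cancel_left, h₂ j hj]

/-- Every output wire repeated `m` times. -/
def spread {n : ℕ} (m : ℕ) (o : Fin n → ZMod 2) : Fin (m * n) → ZMod 2 :=
  fun p => o ⟨p / m, Nat.div_lt_of_lt_mul p.2⟩

theorem spread_wire {n m : ℕ} (o : Fin n → ZMod 2) (j : Fin n) (i : Fin m) :
    spread m o (wire m j i) = o j := by
  unfold spread wire
  congr 1
  ext
  simp only
  have := i.2
  rw [Nat.mul_add_div (by lia), Nat.div_eq_of_lt i.2, add_zero]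

theorem eq_wire {n m : ℕ} (p : Fin (m * n)) : ∃ j i, p = wire m j i := by
  have hm : 0 < m := Nat.pos_of_mul_pos_right (Nat.zero_lt_of_lt p.2)
  exact ⟨⟨p / m, Nat.div_lt_of_lt_mul p.2⟩, ⟨p % m, Nat.mod_lt _ hm⟩,
    Fin.ext (Nat.div_add_mod _ _).symm⟩

theorem sem_rowOut_Z {n m : ℕ} (o : Fin n → ZMod 2) (x : Fin (m * n) → ZMod 2) :
    (rowOut (Z m 1) n).sem o x = kron (spread m o) x := by
  simp only [sem_rowOut, sem_Z, kron_const, sum_kron_mul]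
  simp only [kron]
  rw [Finset.prod_boole]
  congr 1
  simp only [Finset.mem_univ, true_imp_iff, funext_iff, eq_iff_iff]
  constructor
  · intro h p
    obtain ⟨j, i, rfl⟩ := eq_wire p
    rw [spread_wire, h]
  · intro h j i
    rw [← h, spread_wire]

/-- Every wire into the `j`-th Z-spider carries the bit `o j`, and each copy of `D` is joined to
every spider once; hence each copy sees the whole of `o`. This is the common core of both bialgebra
rules. -/
theorem sem_rowOut_shuffle_rowIn (n m : ℕ) (D : ZHTH 1 n) (o : Fin n → ZMod 2)
    (i : Fin m → ZMod 2) :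
    (rowOut (Z m 1) n ∘z shuffle n m ∘z rowIn D m).sem o i = ∏ k, D.sem o fun _ => i k := by
  obtain ⟨e, ⟨he, hs⟩, h⟩ := exists_isWiring_shuffle n m
  rw [sem_comp]
  simp only [sem_rowOut_Z, sum_kron_mul]
  rw [sem_comp]
  simp only [hs, sum_kron_mul, sem_rowIn]
  refine Finset.prod_congr rfl fun k _ => ?_
  congr 1
  funext l
  refine Eq.trans ?_ (spread_wire o l k)
  exact congrArg _ (Fin.ext (h k k.2 l l.2))

/-- Both sides are the indicator that every input bit equals the parity of the outputs. -/
theorem sem_BA1 (n m : ℕ) :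
    (rowOut (Z m 1) n ∘z shuffle n m ∘z rowIn (X 1 n) m).sem = (X 1 n ∘z Z m 1).sem := by
  funext o i
  have hk : ∀ x y : ZMod 2, kron (x + y) 0 = kron x y := fun x y => kron_congr (by
    revert x y; decide)
  rw [sem_rowOut_shuffle_rowIn]
  simp only [sem_X, sem_comp, sem_Z, sum_unique, kron_const, sum_kron_mul, Fin.sum_univ_one, hk]
  rw [kron_pi]
  simp only [kron_comm]

/-- The signs `(-1) ^ (i k * ∏ o)` multiply to `(-1) ^ ((∑ i) * ∏ o)`. -/
theorem sem_BA2 (n m : ℕ) :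
    (rowOut (Z n 1) m ∘z shuffle m n ∘z rowIn (H 1 m) n).sem = (H 1 m ∘z X n 1).sem := by
  funext o i
  have hk : ∀ x y : ZMod 2, kron (x + y) 0 = kron x y := fun x y => kron_congr (by
    revert x y; decide)
  rw [sem_rowOut_shuffle_rowIn]
  simp only [sem_X, sem_comp, sem_H, sum_unique, prod_fin_one, Fin.sum_univ_one, hk,
    sum_mul_kron]
  rw [← sgn_sum, Finset.sum_mul]

/-! ### Soundness of derivations, and the conclusion. -/

theorem Derivable.sem_eq {n m : ℕ} {D D' : ZHTH n m} (h : Derivable D D') : D.sem = D'.sem := by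
  induction h with
  | refl => rfl
  | symm _ ih => exact ih.symm
  | trans _ _ ih ih' => exact ih.trans ih'
  | comp _ _ ih ih' => simp only [sem, ih, ih']
  | tensor _ _ ih ih' => simp only [sem, ih, ih']
  | dagger _ ih =>
    funext o i
    rw [sem_dagger, sem_dagger, ih]
  | id_comp D => exact sem_id_comp D
  | comp_id D => exact sem_comp_id D
  | comp_assoc f g h => exact sem_comp_assoc f g h
  | tensor_id n m => exact sem_tensor_id n m
  | interchange f g f' g' => exact sem_interchange f g f' g'
  | tensor_assoc f g h => exact sem_tensor_assoc f g h
  | unit_tensor D => exact sem_unit_tensor D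
  | tensor_unit D => exact sem_tensor_unit D
  | swap_natural f g => exact sem_swap_natural f g
  | swap_swap n m => exact sem_swap_swap n m
  | hexagon n m k => exact sem_hexagon n m k
  | snake n => exact sem_snake n
  | swap_cup n => exact sem_swap_cup n
  | cup_zero =>
    funext o i
    exact (kron_of_subsingleton (α := Fin 0 → ZMod 2) _ _).trans
      (kron_of_subsingleton (α := Fin 0 → ZMod 2) _ _).symm
  | cup_add n m => exact sem_cup_add n m
  | Z_perm a b m => exact sem_Z_perm a b m
  | H_perm a b m => exact sem_H_perm a b m
  | Z_bend n m => exact sem_Z_bend n m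
  | H_bend n m => exact sem_H_bend n m
  | ZS1 n m => exact sem_ZS1 n m
  | ZS2 => exact sem_ZS2
  | HS1 n m => exact sem_HS1 n m
  | HS2 => exact sem_HS2
  | BA1 n m => exact sem_BA1 n m
  | BA2 n m => exact sem_BA2 n m
  | M => exact sem_M
  | CPH => exact sem_CPH
  | IP => exact sem_IP
  | IV => exact sem_IV
  | Z0 => exact sem_Z0

end ZHTH

theorem mainTheorem7 {n m : ℕ} (D₁ D₂ : ZHTH n m) (h : ZHTH.Derivable D₁ D₂) :
    SOP.THEquiv D₁.toSOP D₂.toSOP :=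
  D₁.denotes_sem.equiv (h.sem_eq ▸ D₂.denotes_sem)
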